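/- **Exact outage probability of the $K$-port FAS with MRC over correlated Rayleigh fading.** Let $1\le K<M$ be integers, $T=M-K-1$, $P_S,\sigma,\alpha>0$, $0\le\mu<1$, $R\ge 0$, and put $\phi=P_S\alpha/\sigma^2$, $\omega=(\phi(1-\mu))^{-1}$, $z=2^R-1$. Let $h_0,e_1,\dots,e_M\sim\mathcal{CN}(0,\alpha)$ be independent circularly symmetric complex Gaussian variables, $h_m=\sqrt{\mu}\,h_0+\sqrt{1-\mu}\,e_m$, and let $\gamma_m=P_S|h_m|^2/\sigma^2$ for $0\le m\le M$ be the SNRs. Let $\mathbb K\subset\{1,\dots,M\}$ be a set of $K$ ports with the $K$ highest values among $\gamma_1,\dots,\gamma_M$ (ties broken arbitrarily), and let $$P_{\rm out}=\Pr\Big(\log_2\Big(1+\sum_{m\in\mathbb K}\gamma_m\Big)\le R\Big).$$ Write $$I_0(x)=\sum_{k\ge0}\frac{x^{2k}}{2^{2k}k!\,\Gamma(k+1)},\quad Q_1(a,b)=\int_b^\infty xe^{-(x^2+a^2)/2}I_0(ax)\,dx,\quad \gamma(\kappa,x)=\int_0^xe^{-t}t^{\kappa-1}dt,$$ $$f_{\gamma_0}(x)=\tfrac1\phi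 e^{-x/\phi},\qquad f_{\gamma_m|\gamma_0=x_0}(x)=\omega e^{-\omega(x+\mu x_0)}I_0\big(2\omega\sqrt{\mu x_0x}\big),$$ $$c_k=\frac{\omega^{2k+1}\mu^k}{(k!)^2},\quad d_k=c_k\,k!,$$ and, for $r,l\in\mathbb Z_{\ge0}^K$ with $l_m\le r_m$ for all $m$, $$\rho=\prod_{m=1}^Kd_{r_m},\quad \eta=\sum_m r_m,\quad \epsilon=\sum_m l_m,\quad q=\prod_m\frac1{l_m!},\quad \chi=K+\eta-\epsilon .$$ Put $$\Psi(v,x_0)=\Big(1-Q_1\big(\sqrt{2\omega\mu x_0},\sqrt{2\omega v}\big)\Big)^T,$$ $$f_{\bar\gamma|\gamma_0=x_0}(x)=e^{-\omega(x+K\mu x_0)}\sum_{r\in\mathbb Z_{\ge0}^K}\rho\,x_0^{\eta}\sum_{0\le l\le r}v^{\epsilon}q\,\frac{(x-Kv)^{\chi-1}}{(\chi-1)!}\qquad(x\ge Kv),$$ $$\Phi(z',v,x_0)=e^{-\omega(Kv+K\mu x_0)}\sum_{r\in\mathbb Z_{\ge0}^K}\rho\,x_0^{\eta}\sum_{0\le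 l\le r}v^{\epsilon}q\,\frac{\gamma(\chi,\omega(z'-Kv))}{(\chi-1)!\,\omega^{\chi}}\quad(z'\ge Kv),$$ and $\Phi(z',v,x_0)=0$ for $z'<Kv$. Then: 1. For almost every $x_0$ with respect to the law of $\gamma_0$, every set $\mathcal T$ of $T$ ports and every $v\ge0$, $\Pr(\gamma_m\le v\ \forall m\in\mathcal T\mid\gamma_0=x_0)=\Psi(v,x_0)$. 2. For all $x_0,v\ge0$ and $x,z'\ge Kv$ the multi-series above converge, $f_{\bar\gamma|\gamma_0=x_0}$ is integrable on $[Kv,z']$, and $\Phi(z',v,x_0)=\int_{Kv}^{z'}f_{\bar\gamma|\gamma_0=x_0}(x)\,dx$. For almost every $x_0$ with respect to the law of $\gamma_0$, every set $\mathcal K$ of $K$ ports, every $v\ge0$ and every real $z'$, $\Pr\big(\gamma_m>v\ \forall m\in\mathcal K,\ \sum_{m\in\mathcal K}\gamma_m\le z'\mid\gamma_0=x_0\big)=\Phi(z',v,x_0)$. 3. The integrand below is integrable on $(0,\infty)\times(0,z/K]$, and $$P_{\rm out}=\int_0^\infty\int_0^{z/K}\binom MK(T+1)\,\Phi(z,v,x_0)\,\Psi(v,x_0)\,f_{\gamma_m|\gamma_0=x_0}(v)\,f_{\gamma_0}(x_0)\,dv\,dx_0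 .$$ -/

import Mathlib

open MeasureTheory ProbabilityTheory

noncomputable section

namespace FAS

/-- The circularly symmetric complex Gaussian law `CN(0, α)`: the real and the imaginary part are
independent centred real Gaussians of variance `α / 2` each. -/
def complexGaussian (α : ℝ) : Measure ℂ :=
  ((gaussianReal 0 (α / 2).toNNReal).prod (gaussianReal 0 (α / 2).toNNReal)).map
    Complex.measurableEquivRealProd.symm

/-- The SNR `P_S |h|² / σ²` of a channel coefficient `h`. -/
def snr (PS σ : ℝ) (h : ℂ) : ℝ := PS * ‖h‖ ^ 2 / σ ^ 2

/-- The coefficient `√μ h₀ + √(1 - μ) e` of a port with correlation factor `μ` to the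
reference coefficient `h₀`. -/
def portChannel (μ : ℝ) (h₀ e : ℂ) : ℂ := (√μ : ℂ) * h₀ + (√(1 - μ) : ℂ) * e

/-- `S` consists of `K` indices at which `g` takes its `K` highest values. -/
def IsTopK {M : ℕ} (K : ℕ) (g : Fin M → ℝ) (S : Finset (Fin M)) : Prop :=
  S.card = K ∧ ∀ i ∈ S, ∀ j ∉ S, g j ≤ g i

/-- The modified Bessel function `I₀` of the first kind of order `0`. -/
def besselI0 (z : ℝ) : ℝ :=
  ∑' k : ℕ, z ^ (2 * k) / (2 ^ (2 * k) * (k.factorial : ℝ) * Real.Gamma (k + 1))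

/-- The first order Marcum `Q`-function. -/
def marcumQ1 (a b : ℝ) : ℝ :=
  ∫ x in Set.Ioi b, x * Real.exp (-(x ^ 2 + a ^ 2) / 2) * besselI0 (a * x)

/-- The lower incomplete Gamma function `γ(κ, x)`. -/
def lowerGamma (κ x : ℝ) : ℝ := ∫ t in (0 : ℝ)..x, Real.exp (-t) * t ^ (κ - 1)

/-- The exponential density of the reference SNR `γ₀`. -/
def refDensity (φ x : ℝ) : ℝ := 1 / φ * Real.exp (-(x / φ))

/-- The (noncentral chi-square) density of a port SNR given `γ₀ = x₀`. -/
def condDensity (ω μ x₀ x : ℝ) : ℝ :=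
  ω * Real.exp (-(ω * (x + μ * x₀))) * besselI0 (2 * ω * √(μ * x₀ * x))

/-- `c_k = ω^(2k+1) μ^k / (k!)²`. -/
def cCoeff (ω μ : ℝ) (k : ℕ) : ℝ := ω ^ (2 * k + 1) * μ ^ k / (k.factorial : ℝ) ^ 2

/-- `d_k = c_k k!`. -/
def dCoeff (ω μ : ℝ) (k : ℕ) : ℝ := cCoeff ω μ k * (k.factorial : ℝ)

/-- `ρ(r) = ∏ d_{r_m}`. -/
def rho (ω μ : ℝ) {K : ℕ} (r : Fin K → ℕ) : ℝ := ∏ m, dCoeff ω μ (r m)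

/-- `χ(r, l) = K + ∑ r_m - ∑ l_m`; it is used for `l ≤ r` only. -/
def chi {K : ℕ} (r l : Fin K → ℕ) : ℕ := K + ∑ m, r m - ∑ m, l m

/-- The multi-indices `l` with `0 ≤ l_m ≤ r_m` for all `m`. -/
def below {K : ℕ} (r : Fin K → ℕ) : Finset (Fin K → ℕ) :=
  Fintype.piFinset fun m => Finset.range (r m + 1)

/-- The term with index `r` of the multi-series in `sumDensity`. -/
def sumDensityTerm (ω μ v x₀ x : ℝ) {K : ℕ} (r : Fin K → ℕ) : ℝ :=
  rho ω μ r * x₀ ^ (∑ m, r m) *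
    ∑ l ∈ below r, v ^ (∑ m, l m) * (∏ m, 1 / ((l m).factorial : ℝ)) *
      ((x - K * v) ^ (chi r l - 1) / ((chi r l - 1).factorial : ℝ))

/-- The (sub-probability) density at `x ≥ K v` of the sum of `K` port SNRs on the event that each
of them exceeds `v`, given `γ₀ = x₀`. -/
def sumDensity (ω μ : ℝ) (K : ℕ) (v x₀ x : ℝ) : ℝ :=
  Real.exp (-(ω * (x + K * μ * x₀))) * ∑' r : Fin K → ℕ, sumDensityTerm ω μ v x₀ x r

/-- The term with index `r` of the multi-series in `Phi`. -/
def phiTerm (ω μ z v x₀ : ℝ) {K : ℕ} (r : Fin K → ℕ) : ℝ :=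
  rho ω μ r * x₀ ^ (∑ m, r m) *
    ∑ l ∈ below r, v ^ (∑ m, l m) * (∏ m, 1 / ((l m).factorial : ℝ)) *
      (lowerGamma (chi r l) (ω * (z - K * v)) /
        (((chi r l - 1).factorial : ℝ) * ω ^ chi r l))

open Classical in
/-- The explicit expression of `Φ(z, v, x₀)`; it is `0` unless `z ≥ K v`. -/
def Phi (ω μ : ℝ) (K : ℕ) (z v x₀ : ℝ) : ℝ :=
  if K * v ≤ z then
    Real.exp (-(ω * (K * v + K * μ * x₀))) * ∑' r : Fin K → ℕ, phiTerm ω μ z v x₀ r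
  else 0

/-- The explicit expression of `Ψ(v, x₀)`. -/
def Psi (ω μ : ℝ) (T : ℕ) (v x₀ : ℝ) : ℝ :=
  (1 - marcumQ1 √(2 * ω * μ * x₀) √(2 * ω * v)) ^ T

/-- The integrand of the double integral for the outage probability, with `T = M - K - 1`. -/
def outageIntegrand (φ ω μ : ℝ) (M K T : ℕ) (z x₀ v : ℝ) : ℝ :=
  (M.choose K : ℝ) * (T + 1) * Phi ω μ K z v x₀ * Psi ω μ T v x₀ *
    condDensity ω μ x₀ v * refDensity φ x₀

end FAS

end

noncomputable section

namespace FAS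

/-! ### The modified Bessel function -/

/-! Fix the reference coefficient `a`. The ports are then independent, and `√μ a + √(1-μ) e` is a
complex Gaussian centred at `√μ a`. By circular symmetry the law of its squared modulus depends on
`a` only through `|a|²`. In polar coordinates the angular integral produces `I₀`, so the law is
`portLaw` (`map_snr_portChannel`). Hence, given `γ₀ = x₀`, the port SNRs are i.i.d. with law
`portLaw ω μ x₀` (`map_prod_snr_eq_compProd`, `condDistrib_portSNR`), and `Ψ` is a power of a
one-dimensional distribution function.

For `Φ`, expand `I₀` in its power series and `(u + v)^k` by the binomial theorem. The law of one
port restricted to `(v, ∞)` and shifted by `v` becomes a nonnegative mixture of the densities `uⁿ/n!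
· e^{-ωu}`. Convolution of these only adds exponents (a Beta integral), and the mixture over all `K`
ports is the multi-series (`lintegral_pi_sum_of_mixture`, `lintegral_pi_sum_portLaw`). All terms are
nonnegative, so the computation takes place in `ENNReal` with Tonelli, and convergence of the real
series follows from the total mass being at most one.

For the outage, ties have probability zero. The event therefore splits into almost disjoint pieces
indexed by the set `S` of the best `K` ports and the next best port `j`: `M.choose K * (T + 1)`
pairs. Given `y j = v`, the ports in `S` and the remaining `T` ports are independent and contribute
`Φ` and `Ψ` (`pi_orderEvent`). It remains to integrate over `v` against `portLaw` and over `x₀`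
against the exponential law of `γ₀`. -/

lemma hasSum_besselI0 (x : ℝ) :
    HasSum (fun k : ℕ => x ^ (2 * k) / (2 ^ (2 * k) * (k.factorial : ℝ) ^ 2)) (besselI0 x) := by
  have h : besselI0 x = ∑' k : ℕ, x ^ (2 * k) / (2 ^ (2 * k) * (k.factorial : ℝ) ^ 2) := by
    unfold besselI0
    congr 1 with k
    rw [Real.Gamma_nat_eq_factorial]
    ring
  rw [h]
  apply Summable.hasSum
  refine Summable.of_nonneg_of_le (fun k => ?_) (fun k => ?_)
    (Real.summable_pow_div_factorial (x ^ 2 / 4))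
  · rw [pow_mul]; positivity
  · have h1 : (1 : ℝ) ≤ k.factorial := by exact_mod_cast Nat.one_le_iff_ne_zero.2 k.factorial_ne_zero
    rw [div_pow, div_div, pow_mul, pow_mul]
    norm_num
    gcongr
    nlinarith

lemma besselI0_nonneg (x : ℝ) : 0 ≤ besselI0 x :=
  (hasSum_besselI0 x).nonneg fun k => by rw [pow_mul]; positivity

lemma integral_cos_pow_even (k : ℕ) :
    ∫ θ in -Real.pi..Real.pi, Real.cos θ ^ (2 * k) =
      2 * Real.pi * (2 * k).factorial / (2 ^ (2 * k) * (k.factorial : ℝ) ^ 2) := by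
  induction k with
  | zero => simp; ring
  | succ k ih =>
    rw [show 2 * (k + 1) = 2 * k + 2 by ring, integral_cos_pow, ih]
    simp only [Real.sin_neg, Real.sin_pi, Nat.factorial_succ]
    push_cast
    field_simp
    ring

lemma integral_cos_pow_odd (k : ℕ) :
    ∫ θ in -Real.pi..Real.pi, Real.cos θ ^ (2 * k + 1) = 0 := by
  induction k with
  | zero => simp
  | succ k ih =>
    rw [show 2 * (k + 1) + 1 = 2 * k + 1 + 2 by ring, integral_cos_pow, ih]
    simp

/-- Expand the exponential and integrate term by term: odd moments of the cosine vanish and even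
ones give the Bessel series. This form also yields continuity of `besselI0`. -/
lemma integral_exp_mul_cos (x : ℝ) :
    ∫ θ in -Real.pi..Real.pi, Real.exp (x * Real.cos θ) = 2 * Real.pi * besselI0 x := by
  have h1 : HasSum (fun n : ℕ => ∫ θ in -Real.pi..Real.pi,
      (x * Real.cos θ) ^ n / (n.factorial : ℝ))
      (∫ θ in -Real.pi..Real.pi, Real.exp (x * Real.cos θ)) := by
    refine intervalIntegral.hasSum_integral_of_dominated_convergence
      (fun n _ => |x| ^ n / (n.factorial : ℝ)) (fun n => by fun_prop) (fun n => ?_) ?_ ?_ ?_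
    · refine .of_forall fun θ _ => ?_
      rw [norm_div, norm_pow, norm_mul, Real.norm_natCast]
      gcongr
      calc |x| * ‖Real.cos θ‖ ≤ |x| * 1 := by gcongr; exact Real.abs_cos_le_one θ
        _ = |x| := mul_one _
    · exact .of_forall fun θ _ => Real.summable_pow_div_factorial |x|
    · exact _root_.intervalIntegrable_const
    · refine .of_forall fun θ _ => ?_
      rw [Real.exp_eq_exp_ℝ]
      exact NormedSpace.expSeries_div_hasSum_exp _
  have h2 : ∀ n : ℕ, ∫ θ in -Real.pi..Real.pi, (x * Real.cos θ) ^ n / (n.factorial : ℝ) =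
      x ^ n / n.factorial * ∫ θ in -Real.pi..Real.pi, Real.cos θ ^ n := fun n => by
    rw [← intervalIntegral.integral_const_mul]
    congr 1 with θ
    ring
  simp_rw [h2] at h1
  have h3 := (hasSum_besselI0 x).mul_left (2 * Real.pi)
  set F : ℕ → ℝ := fun n => x ^ n / n.factorial * ∫ θ in -Real.pi..Real.pi, Real.cos θ ^ n
    with hF
  have he : HasSum (fun k : ℕ => F (2 * k)) (2 * Real.pi * besselI0 x) := by
    refine h3.congr_fun fun k => ?_
    simp only [hF]
    rw [integral_cos_pow_even]
    have : ((2 * k).factorial : ℝ) ≠ 0 := by positivity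
    field_simp
  have ho : HasSum (fun k : ℕ => F (2 * k + 1)) 0 := by
    simp only [hF, integral_cos_pow_odd, mul_zero]
    exact hasSum_zero
  have h4 := he.even_add_odd ho
  rw [add_zero] at h4
  exact h1.unique h4

lemma continuous_besselI0 : Continuous besselI0 := by
  have h : besselI0 = fun x => (2 * Real.pi)⁻¹ *
      ∫ θ in -Real.pi..Real.pi, Real.exp (x * Real.cos θ) := by
    ext x
    rw [integral_exp_mul_cos]
    field_simp
  rw [h]
  refine continuous_const.mul
    (intervalIntegral.continuous_parametric_intervalIntegral_of_continuous' ?_ _ _)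
  unfold Function.uncurry
  fun_prop

lemma integral_exp_mul_cos_sub (x θ₀ : ℝ) :
    ∫ θ in -Real.pi..Real.pi, Real.exp (x * Real.cos (θ - θ₀)) = 2 * Real.pi * besselI0 x := by
  have hp : Function.Periodic (fun θ => Real.exp (x * Real.cos θ)) (2 * Real.pi) := fun θ => by
    simp
  rw [intervalIntegral.integral_comp_sub_right (fun θ => Real.exp (x * Real.cos θ)) θ₀,
    ← integral_exp_mul_cos]
  have := hp.intervalIntegral_add_eq (-Real.pi - θ₀) (-Real.pi)
  convert this using 2 <;> ring

/-- The angular part of a circularly symmetric Gaussian integral in polar coordinates. -/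
lemma lintegral_exp_linear_cos_sin (p q : ℝ) :
    ∫⁻ θ in Set.Ioo (-Real.pi) Real.pi,
        ENNReal.ofReal (Real.exp (p * Real.cos θ + q * Real.sin θ)) =
      ENNReal.ofReal (2 * Real.pi * besselI0 √(p ^ 2 + q ^ 2)) := by
  -- Amplitude-phase form, with the argument of `p + iq` as the phase.
  have hpq : ∀ θ, p * Real.cos θ + q * Real.sin θ =
      √(p ^ 2 + q ^ 2) * Real.cos (θ - Complex.arg ⟨p, q⟩) := fun θ => by
    have hn : ‖(⟨p, q⟩ : ℂ)‖ = √(p ^ 2 + q ^ 2) := by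
      rw [Complex.norm_def, Complex.normSq_mk]; ring_nf
    have h1 := Complex.norm_mul_cos_arg ⟨p, q⟩
    have h2 := Complex.norm_mul_sin_arg ⟨p, q⟩
    rw [hn] at h1 h2
    simp only at h1 h2
    rw [Real.cos_sub]
    linear_combination (-Real.cos θ) * h1 - Real.sin θ * h2
  simp_rw [hpq]
  rw [← integral_exp_mul_cos_sub _ (Complex.arg ⟨p, q⟩),
    intervalIntegral.integral_of_le (by linarith [Real.pi_pos]), integral_Ioc_eq_integral_Ioo,
    ofReal_integral_eq_lintegral_ofReal]
  · exact (Continuous.integrableOn_Icc (by fun_prop)).mono_set Set.Ioo_subset_Icc_self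
  · exact .of_forall fun _ => (Real.exp_pos _).le

/-! ### The law of a port SNR -/

/-- The law on `(0, ∞)` with density `condDensity ω μ x₀`. -/
def portLaw (ω μ x₀ : ℝ) : Measure ℝ :=
  (volume.restrict (Set.Ioi 0)).withDensity fun x => ENNReal.ofReal (condDensity ω μ x₀ x)

@[fun_prop]
lemma measurable_besselI0 : Measurable besselI0 := continuous_besselI0.measurable

@[fun_prop]
lemma measurable_condDensity (ω μ : ℝ) :
    Measurable fun p : ℝ × ℝ => condDensity ω μ p.1 p.2 := by
  unfold condDensity
  fun_prop

@[fun_prop]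
lemma measurable_condDensity_right (ω μ x₀ : ℝ) : Measurable (condDensity ω μ x₀) :=
  (measurable_condDensity ω μ).comp measurable_prodMk_left

lemma condDensity_nonneg {ω : ℝ} (hω : 0 ≤ ω) (μ x₀ x : ℝ) : 0 ≤ condDensity ω μ x₀ x :=
  mul_nonneg (mul_nonneg hω (Real.exp_pos _).le) (besselI0_nonneg _)

/-- Because the density is finite everywhere, `f` need not be measurable. This is convenient when
`f` is a product of probabilities as a function of the threshold. -/
lemma lintegral_portLaw (ω μ x₀ : ℝ) (f : ℝ → ENNReal) :
    ∫⁻ x, f x ∂portLaw ω μ x₀ =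
      ∫⁻ x in Set.Ioi 0, ENNReal.ofReal (condDensity ω μ x₀ x) * f x := by
  unfold portLaw
  rw [lintegral_withDensity_eq_lintegral_mul_non_measurable _ (by fun_prop)
    (.of_forall fun _ => ENNReal.ofReal_lt_top)]
  rfl

lemma lintegral_gaussianReal {b : ℝ} {v : NNReal} (hv : v ≠ 0) {f : ℝ → ENNReal}
    (hf : Measurable f) :
    ∫⁻ x, f x ∂gaussianReal b v = ∫⁻ x, gaussianPDF b v x * f x := by
  rw [gaussianReal_of_var_ne_zero _ hv,
    lintegral_withDensity_eq_lintegral_mul _ (measurable_gaussianPDF b v) hf]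
  rfl

lemma lintegral_gaussianReal_prod {b₁ b₂ : ℝ} {v : NNReal} (hv : v ≠ 0) {f : ℝ × ℝ → ENNReal}
    (hf : Measurable f) :
    ∫⁻ p, f p ∂(gaussianReal b₁ v).prod (gaussianReal b₂ v) =
      ∫⁻ p : ℝ × ℝ, gaussianPDF b₁ v p.1 * gaussianPDF b₂ v p.2 * f p := by
  have h2 := measurable_gaussianPDF b₂ v
  have h1 := measurable_gaussianPDF b₁ v
  rw [lintegral_prod _ hf.aemeasurable, lintegral_gaussianReal hv (hf.lintegral_prod_right'),
    Measure.volume_eq_prod, lintegral_prod _ (by fun_prop)]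
  congr 1 with x
  rw [lintegral_gaussianReal (f := fun y => f (x, y)) hv (hf.comp measurable_prodMk_left),
    ← lintegral_const_mul _ (by fun_prop)]
  simp only [mul_assoc]

/-- The substitution `t = c r²` converts between a radius and an SNR; it serves both the polar
integral and the Marcum function. -/
lemma lintegral_Ioi_comp_const_mul_sq {c s : ℝ} (hc : 0 < c) (hs : 0 ≤ s) (f : ℝ → ENNReal) :
    ∫⁻ t in Set.Ioi (c * s ^ 2), f t =
      ∫⁻ r in Set.Ioi s, ENNReal.ofReal (2 * c * r) * f (c * r ^ 2) := by
  have himg : (fun r : ℝ => c * r ^ 2) '' Set.Ioi s = Set.Ioi (c * s ^ 2) := by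
    ext t
    constructor
    · rintro ⟨r, hr, rfl⟩
      have hr' : s < r := hr
      simp only [Set.mem_Ioi]
      gcongr
    · intro ht
      have ht' : c * s ^ 2 < t := ht
      have h0 : 0 ≤ t := le_trans (by positivity) ht'.le
      refine ⟨√(t / c), Real.lt_sqrt_of_sq_lt ?_, ?_⟩
      · rwa [lt_div_iff₀' hc]
      · simp only
        rw [Real.sq_sqrt (by positivity)]
        field_simp
  have := lintegral_image_eq_lintegral_deriv_mul_of_monotoneOn (s := Set.Ioi s)
    (f := fun r => c * r ^ 2) (f' := fun r => 2 * c * r) measurableSet_Ioi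
    (fun r _ => by
      have := ((hasDerivAt_id r).pow 2).const_mul c
      simp only [id] at this
      refine (this.congr_deriv ?_).hasDerivWithinAt
      simp; ring)
    (fun a ha b hb hab => by
      have ha' : 0 ≤ a := hs.trans (le_of_lt ha)
      simp only
      gcongr) f
  rw [himg] at this
  exact this

lemma gaussianPDF_mul_gaussianPDF_polar {b₁ b₂ : ℝ} {v : NNReal} (hv : v ≠ 0) (r θ : ℝ) :
    gaussianPDF b₁ v (r * Real.cos θ) * gaussianPDF b₂ v (r * Real.sin θ) =
      ENNReal.ofReal ((2 * Real.pi * v)⁻¹ *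
        Real.exp (-((r ^ 2 + (b₁ ^ 2 + b₂ ^ 2)) / (2 * v)))) *
      ENNReal.ofReal (Real.exp (r * b₁ / v * Real.cos θ + r * b₂ / v * Real.sin θ)) := by
  have hv' : (0 : ℝ) < v := by positivity
  have h0 : (0 : ℝ) ≤ 2 * Real.pi * v := by positivity
  unfold gaussianPDF
  rw [← ENNReal.ofReal_mul (gaussianPDFReal_nonneg _ _ _), ← ENNReal.ofReal_mul (by positivity)]
  congr 1
  unfold gaussianPDFReal
  rw [mul_mul_mul_comm, ← Real.exp_add, ← mul_inv, Real.mul_self_sqrt h0,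
    mul_assoc (2 * Real.pi * (v : ℝ))⁻¹, ← Real.exp_add]
  congr 2
  field_simp
  linear_combination (-r ^ 2) * Real.sin_sq_add_cos_sq θ

/-- In polar coordinates the mean enters through the exponential of a linear form in `cos θ` and
`sin θ`, whose angular integral is `I₀`; the radius is then replaced by `c r²`. Only the product `μ
* x₀` matters, since `condDensity` depends on nothing else. -/
lemma lintegral_sq_norm_gaussianReal_prod {b₁ b₂ c μ x₀ : ℝ} {v : NNReal} (hv : v ≠ 0)
    (hc : 0 < c) (hx : μ * x₀ = c * (b₁ ^ 2 + b₂ ^ 2)) {f : ℝ → ENNReal} (hf : Measurable f) :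
    ∫⁻ p, f (c * (p.1 ^ 2 + p.2 ^ 2)) ∂(gaussianReal b₁ v).prod (gaussianReal b₂ v) =
      ∫⁻ x, f x ∂portLaw (2 * v * c)⁻¹ μ x₀ := by
  have hv' : (0 : ℝ) < v := by positivity
  have h2 := measurable_gaussianPDF b₂ v
  have h1 := measurable_gaussianPDF b₁ v
  have hsub := lintegral_Ioi_comp_const_mul_sq hc le_rfl
    fun x => ENNReal.ofReal (condDensity (2 * v * c)⁻¹ μ x₀ x) * f x
  rw [zero_pow two_ne_zero, mul_zero] at hsub
  rw [lintegral_gaussianReal_prod hv (by fun_prop), lintegral_portLaw, hsub, ← lintegral_comp_polarCoord_symm, polarCoord_target,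
    Measure.volume_eq_prod, ← Measure.prod_restrict, lintegral_prod _ ?_]
  swap
  · simp only [polarCoord_symm_apply, smul_eq_mul]
    fun_prop
  refine setLIntegral_congr_fun measurableSet_Ioi fun r hr => ?_
  have hr' : 0 < r := hr
  simp only [polarCoord_symm_apply, smul_eq_mul, gaussianPDF_mul_gaussianPDF_polar hv]
  have hsq : ∀ θ, (r * Real.cos θ) ^ 2 + (r * Real.sin θ) ^ 2 = r ^ 2 := fun θ => by
    linear_combination r ^ 2 * Real.sin_sq_add_cos_sq θ
  simp_rw [hsq]
  set A := ENNReal.ofReal ((2 * Real.pi * v)⁻¹ *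
        Real.exp (-((r ^ 2 + (b₁ ^ 2 + b₂ ^ 2)) / (2 * v)))) with hA
  have hre : ∀ E : ENNReal, ENNReal.ofReal r * (A * E * f (c * r ^ 2)) =
      ENNReal.ofReal r * A * f (c * r ^ 2) * E := fun E => by ring
  simp_rw [hre]
  rw [lintegral_const_mul _ (by fun_prop), lintegral_exp_linear_cos_sin, hA,
    mul_right_comm, ← mul_assoc]
  congr 1
  have hI := besselI0_nonneg √((r * b₁ / v) ^ 2 + (r * b₂ / v) ^ 2)
  rw [← ENNReal.ofReal_mul hr'.le, ← ENNReal.ofReal_mul (by positivity),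
    ← ENNReal.ofReal_mul (by positivity)]
  congr 1
  unfold condDensity
  have harg : 2 * (2 * v * c)⁻¹ * √(μ * x₀ * (c * r ^ 2)) =
      √((r * b₁ / v) ^ 2 + (r * b₂ / v) ^ 2) := by
    rw [hx]
    symm
    rw [Real.sqrt_eq_iff_mul_self_eq (by positivity) (by positivity), ← sq, mul_pow,
      Real.sq_sqrt (by positivity)]
    field_simp
  rw [harg, hx]
  have hexp : -((2 * (v : ℝ) * c)⁻¹ * (c * r ^ 2 + c * (b₁ ^ 2 + b₂ ^ 2))) =
      -((r ^ 2 + (b₁ ^ 2 + b₂ ^ 2)) / (2 * v)) := by field_simp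
  rw [hexp]
  field_simp

lemma map_portChannel_complexGaussian {α μ : ℝ} (hμ₁ : μ < 1) (a : ℂ) :
    (complexGaussian α).map (portChannel μ a) =
      ((gaussianReal (√μ * a.re) ((1 - μ) * α / 2).toNNReal).prod
        (gaussianReal (√μ * a.im) ((1 - μ) * α / 2).toNNReal)).map
          Complex.measurableEquivRealProd.symm := by
  have hb : ∀ b : ℝ, (gaussianReal 0 (α / 2).toNNReal).map (fun x => b + √(1 - μ) * x) =
      gaussianReal b ((1 - μ) * α / 2).toNNReal := fun b => by
    have : (fun x => b + √(1 - μ) * x) = (fun x => b + x) ∘ (fun x => √(1 - μ) * x) := rfl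
    rw [this, ← Measure.map_map (by fun_prop) (by fun_prop), gaussianReal_map_const_mul,
      gaussianReal_map_const_add]
    congr 1
    · simp
    · rw [mul_div_assoc, Real.toNNReal_mul (by linarith)]
      congr 1
      ext
      simp [Real.sq_sqrt (show (0 : ℝ) ≤ 1 - μ by linarith), hμ₁.le]
  rw [← hb, ← hb, Measure.map_prod_map _ _ (by fun_prop) (by fun_prop),
    Measure.map_map (by fun_prop) (by fun_prop), complexGaussian,
    Measure.map_map (by unfold portChannel; fun_prop) (by fun_prop)]
  congr 1
  ext p
  simp only [Function.comp, portChannel, Complex.measurableEquivRealProd_symm_apply]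
  apply Complex.ext <;> simp

@[fun_prop]
lemma measurable_snr (PS σ : ℝ) : Measurable (snr PS σ) := by
  unfold snr
  fun_prop

lemma snr_nonneg {PS : ℝ} (hPS : 0 ≤ PS) (σ : ℝ) (h : ℂ) : 0 ≤ snr PS σ h := by
  unfold snr
  positivity

@[fun_prop]
lemma measurable_portChannel (μ : ℝ) :
    Measurable fun p : ℂ × ℂ => portChannel μ p.1 p.2 := by
  unfold portChannel
  fun_prop

@[fun_prop]
lemma measurable_portChannel_right (μ : ℝ) (a : ℂ) : Measurable (portChannel μ a) :=
  (measurable_portChannel μ).comp measurable_prodMk_left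

/-- Given the reference coefficient `a`, the SNR of a port has law `portLaw` with parameter the
reference SNR. -/
lemma map_snr_portChannel {PS σ α μ : ℝ} (hPS : 0 < PS) (hσ : 0 < σ) (hα : 0 < α) (hμ₀ : 0 ≤ μ)
    (hμ₁ : μ < 1) (a : ℂ) :
    (complexGaussian α).map (fun e => snr PS σ (portChannel μ a e)) =
      portLaw (PS * α / σ ^ 2 * (1 - μ))⁻¹ μ (snr PS σ a) := by
  have h1 : (fun e => snr PS σ (portChannel μ a e)) = snr PS σ ∘ portChannel μ a := rfl
  have hs : 0 < (1 - μ) * α / 2 := by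
    have : 0 < 1 - μ := by linarith
    positivity
  rw [h1, ← Measure.map_map (by fun_prop) (by fun_prop), map_portChannel_complexGaussian hμ₁,
    Measure.map_map (by fun_prop) (by fun_prop)]
  refine Measure.ext_of_lintegral _ fun f hf => ?_
  rw [lintegral_map hf (by fun_prop)]
  have hω : (PS * α / σ ^ 2 * (1 - μ))⁻¹ =
      (2 * ((1 - μ) * α / 2).toNNReal * (PS / σ ^ 2))⁻¹ := by
    rw [Real.coe_toNNReal _ hs.le]
    field_simp
  rw [hω, ← lintegral_sq_norm_gaussianReal_prod (b₁ := √μ * a.re) (b₂ := √μ * a.im)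
    (by simpa using hs) (by positivity) ?_ hf]
  · congr 1 with p
    simp only [Function.comp, snr, Complex.measurableEquivRealProd_symm_apply]
    rw [← Complex.normSq_eq_norm_sq, Complex.normSq_mk]
    congr 1
    ring
  · rw [mul_pow, mul_pow, Real.sq_sqrt hμ₀, snr, ← Complex.normSq_eq_norm_sq,
      Complex.normSq_apply]
    ring

/-- No integral has to be computed: the measure is the law of an actual port SNR, for unit powers,
gain `(ω(1-μ))⁻¹` and reference coefficient `√x₀`. -/
lemma isProbabilityMeasure_portLaw {ω μ x₀ : ℝ} (hω : 0 < ω) (hμ₀ : 0 ≤ μ) (hμ₁ : μ < 1)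
    (hx₀ : 0 ≤ x₀) : IsProbabilityMeasure (portLaw ω μ x₀) := by
  have h1 : 0 < 1 - μ := by linarith
  have h := map_snr_portChannel (PS := 1) (σ := 1) (α := (ω * (1 - μ))⁻¹) one_pos one_pos
    (by positivity) hμ₀ hμ₁ ((√x₀ : ℝ) : ℂ)
  have hω' : (1 * (ω * (1 - μ))⁻¹ / 1 ^ 2 * (1 - μ))⁻¹ = ω := by field_simp
  have hx : snr 1 1 ((√x₀ : ℝ) : ℂ) = x₀ := by
    simp [snr, Real.sq_sqrt hx₀]
  rw [hω', hx] at h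
  rw [← h, complexGaussian]
  have : IsProbabilityMeasure (((gaussianReal 0 ((ω * (1 - μ))⁻¹ / 2).toNNReal).prod
      (gaussianReal 0 ((ω * (1 - μ))⁻¹ / 2).toNNReal)).map
      Complex.measurableEquivRealProd.symm) :=
    Measure.isProbabilityMeasure_map (by fun_prop)
  exact Measure.isProbabilityMeasure_map (by fun_prop)

instance (ω μ x₀ : ℝ) : NullSingletonClass (portLaw ω μ x₀) := by
  unfold portLaw
  infer_instance

instance (α : ℝ) : IsProbabilityMeasure (complexGaussian α) :=
  Measure.isProbabilityMeasure_map (by fun_prop)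

lemma toReal_portLaw_Ioi {ω μ x₀ v : ℝ} (hω : 0 < ω) (hμ₀ : 0 ≤ μ) (hx₀ : 0 ≤ x₀) (hv : 0 ≤ v) :
    (portLaw ω μ x₀).real (Set.Ioi v) = marcumQ1 √(2 * ω * μ * x₀) √(2 * ω * v) := by
  unfold marcumQ1
  rw [integral_eq_lintegral_of_nonneg_ae, Measure.real, portLaw,
    withDensity_apply _ measurableSet_Ioi, Measure.restrict_restrict measurableSet_Ioi,
    Set.Ioi_inter_Ioi, sup_of_le_left hv]
  · congr 1
    -- The scaling `x = r²/(2ω)` turns the port density into the Marcum integrand.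
    have h := lintegral_Ioi_comp_const_mul_sq (c := (2 * ω)⁻¹) (s := √(2 * ω * v)) (by positivity)
      (Real.sqrt_nonneg _) fun x => ENNReal.ofReal (condDensity ω μ x₀ x)
    rw [Real.sq_sqrt (by positivity), mul_assoc 2 ω v, mul_inv, show
      2⁻¹ * ω⁻¹ * (2 * (ω * v)) = v by field_simp] at h
    rw [h, mul_assoc 2 ω v]
    refine setLIntegral_congr_fun measurableSet_Ioi fun r hr => ?_
    have hr' : 0 ≤ r := (Real.sqrt_nonneg _).trans (le_of_lt hr)
    rw [← ENNReal.ofReal_mul (by positivity)]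
    congr 1
    unfold condDensity
    have harg : 2 * ω * √(μ * x₀ * (2⁻¹ * ω⁻¹ * r ^ 2)) = √(2 * ω * μ * x₀) * r := by
      rw [← sq_eq_sq₀ (by positivity) (by positivity), mul_pow, mul_pow _ r,
        Real.sq_sqrt (by positivity), Real.sq_sqrt (by positivity)]
      field_simp
    have hexp : -(ω * (2⁻¹ * ω⁻¹ * r ^ 2 + μ * x₀)) =
        -(r ^ 2 + √(2 * ω * μ * x₀) ^ 2) / 2 := by
      rw [Real.sq_sqrt (by positivity)]
      field_simp
    rw [harg, hexp]
    field_simp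
  · refine (ae_restrict_mem measurableSet_Ioi).mono fun r hr => ?_
    have hr' : 0 ≤ r := (Real.sqrt_nonneg _).trans (le_of_lt hr)
    exact mul_nonneg (mul_nonneg hr' (Real.exp_pos _).le) (besselI0_nonneg _)
  · exact Measurable.aestronglyMeasurable (by fun_prop)

lemma toReal_portLaw_Iic {ω μ x₀ v : ℝ} (hω : 0 < ω) (hμ₀ : 0 ≤ μ) (hμ₁ : μ < 1) (hx₀ : 0 ≤ x₀)
    (hv : 0 ≤ v) :
    (portLaw ω μ x₀).real (Set.Iic v) = 1 - marcumQ1 √(2 * ω * μ * x₀) √(2 * ω * v) := by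
  have := isProbabilityMeasure_portLaw hω hμ₀ hμ₁ hx₀
  rw [← toReal_portLaw_Ioi hω hμ₀ hx₀ hv, ← Set.compl_Ioi,
    probReal_compl_eq_one_sub measurableSet_Ioi]

/-- The probability that the ports in `S` all have SNR at most `v`, given the reference SNR. -/
lemma pi_portLaw_forall_le {ω μ x₀ v : ℝ} (hω : 0 < ω) (hμ₀ : 0 ≤ μ) (hμ₁ : μ < 1) (hx₀ : 0 ≤ x₀)
    (hv : 0 ≤ v) {M : ℕ} (S : Finset (Fin M)) :
    (Measure.pi fun _ : Fin M => portLaw ω μ x₀).real {y | ∀ m ∈ S, y m ≤ v} =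
      Psi ω μ S.card v x₀ := by
  classical
  have := isProbabilityMeasure_portLaw hω hμ₀ hμ₁ hx₀
  have hset : {y : Fin M → ℝ | ∀ m ∈ S, y m ≤ v} =
      Set.univ.pi fun m => if m ∈ S then Set.Iic v else Set.univ := by
    ext y
    simp only [Set.mem_ofPred_eq, Set.mem_univ_pi]
    refine forall_congr' fun m => ?_
    by_cases h : m ∈ S <;> simp [h]
  rw [hset, Psi, ← toReal_portLaw_Iic hω hμ₀ hμ₁ hx₀ hv, Measure.real, Measure.pi_pi,
    ENNReal.toReal_prod]
  calc ∏ m, ((portLaw ω μ x₀) (if m ∈ S then Set.Iic v else Set.univ)).toReal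
      = ∏ m, if m ∈ S then (portLaw ω μ x₀).real (Set.Iic v) else 1 := by
        refine Finset.prod_congr rfl fun m _ => ?_
        split_ifs <;> simp [Measure.real]
    _ = _ := by simp [Finset.prod_ite_mem]

lemma besselI0_zero : besselI0 0 = 1 := by
  have h := (hasSum_besselI0 0).unique (hasSum_single 0 fun k hk => by simp [hk])
  simpa using h

lemma condDensity_zero (ω x₀ x : ℝ) : condDensity ω 0 x₀ x = ω * Real.exp (-(ω * x)) := by
  simp [condDensity, besselI0_zero]

/-- The law of the reference SNR. -/
lemma map_snr_complexGaussian {PS σ α : ℝ} (hPS : 0 < PS) (hσ : 0 < σ) (hα : 0 < α) :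
    (complexGaussian α).map (snr PS σ) =
      (volume.restrict (Set.Ioi 0)).withDensity
        fun x => ENNReal.ofReal (refDensity (PS * α / σ ^ 2) x) := by
  -- With correlation zero a port is a copy of the reference channel, and `I₀(0) = 1` leaves an
  -- exponential density.
  have h := map_snr_portChannel hPS hσ hα le_rfl one_pos 0
  have h2 : (fun e => snr PS σ (portChannel 0 0 e)) = snr PS σ := by
    ext e
    simp [portChannel]
  rw [h2] at h
  rw [h, portLaw]
  congr 1 with x
  rw [condDensity_zero, refDensity]
  congr 1
  field_simp
  simp

/-! ### Convolutions of monomials on the half line -/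

/-- The Beta integral with integer parameters. Each integration by parts moves one power from `t -
u` to `u`, so `a` has to vary in the induction. -/
lemma integral_pow_mul_sub_pow (a b : ℕ) (t : ℝ) :
    ∫ u in (0 : ℝ)..t, u ^ a / a.factorial * ((t - u) ^ b / b.factorial) =
      t ^ (a + b + 1) / (a + b + 1).factorial := by
  induction b generalizing a with
  | zero =>
    simp only [pow_zero, Nat.factorial_zero, Nat.cast_one, div_one, mul_one, add_zero]
    rw [intervalIntegral.integral_div, integral_pow, Nat.factorial_succ]
    push_cast
    simp
    field_simp
  | succ b ih =>
    have hu : ∀ u ∈ Set.uIcc 0 t, HasDerivAt (fun u : ℝ => (t - u) ^ (b + 1) / (b + 1).factorial)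
        (-((t - u) ^ b / b.factorial)) u := fun u _ => by
      have h := (((hasDerivAt_id u).const_sub t).pow (b + 1)).div_const ((b + 1).factorial : ℝ)
      refine h.congr_deriv ?_
      rw [Nat.factorial_succ]
      push_cast
      simp
      field_simp
    have hv : ∀ u ∈ Set.uIcc 0 t, HasDerivAt (fun u : ℝ => u ^ (a + 1) / (a + 1).factorial)
        (u ^ a / a.factorial) u := fun u _ => by
      have h := ((hasDerivAt_id u).pow (a + 1)).div_const ((a + 1).factorial : ℝ)
      refine h.congr_deriv ?_
      rw [Nat.factorial_succ]
      push_cast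
      simp
      field_simp
    have h := intervalIntegral.integral_mul_deriv_eq_deriv_mul hu hv
      (Continuous.intervalIntegrable (by fun_prop) _ _)
      (Continuous.intervalIntegrable (by fun_prop) _ _)
    simp_rw [mul_comm (_ / (a.factorial : ℝ))]
    rw [h]
    have h2 : ∀ u : ℝ, -((t - u) ^ b / b.factorial) * (u ^ (a + 1) / (a + 1).factorial) =
      -(u ^ (a + 1) / (a + 1).factorial * ((t - u) ^ b / b.factorial)) := fun u => by ring
    simp_rw [h2]
    rw [intervalIntegral.integral_neg, ih (a + 1)]
    rw [show a + 1 + b + 1 = a + (b + 1) + 1 by ring]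
    simp

/-- The function `u ↦ uⁿ / n!` on `(0, ∞)`, extended by `0`. -/
def powKernel (n : ℕ) : ℝ → ENNReal :=
  (Set.Ioi 0).indicator fun u => ENNReal.ofReal (u ^ n / n.factorial)

@[fun_prop]
lemma measurable_powKernel (n : ℕ) : Measurable (powKernel n) :=
  Measurable.indicator (by fun_prop) measurableSet_Ioi

lemma lintegral_powKernel_mul (n : ℕ) (f : ℝ → ENNReal) :
    ∫⁻ u, powKernel n u * f u =
      ∫⁻ u in Set.Ioi 0, ENNReal.ofReal (u ^ n / n.factorial) * f u := by
  rw [← lintegral_indicator measurableSet_Ioi]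
  congr 1 with u
  unfold powKernel
  by_cases hu : u ∈ Set.Ioi 0 <;> simp [hu]

lemma lintegral_powKernel_mul_powKernel (a b : ℕ) (t : ℝ) :
    ∫⁻ u, powKernel a u * powKernel b (t - u) = powKernel (a + b + 1) t := by
  by_cases ht : 0 < t
  · have h1 : ∀ u, powKernel a u * powKernel b (t - u) = (Set.Ioo 0 t).indicator
        (fun u => ENNReal.ofReal (u ^ a / a.factorial * ((t - u) ^ b / b.factorial))) u := by
      intro u
      unfold powKernel
      by_cases h0 : 0 < u
      · by_cases hut : u < t
        · have h2 : 0 ≤ u ^ a / a.factorial := by positivity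
          simp [h0, hut, ENNReal.ofReal_mul h2]
        · simp [hut]
      · simp [h0]
    simp_rw [h1]
    rw [lintegral_indicator measurableSet_Ioo, setLIntegral_congr Ioo_ae_eq_Ioc,
      ← ofReal_integral_eq_lintegral_ofReal, ← intervalIntegral.integral_of_le ht.le,
      integral_pow_mul_sub_pow]
    · simp [powKernel, ht]
    · exact (Continuous.integrableOn_Icc (by fun_prop)).mono_set Set.Ioc_subset_Icc_self
    · refine (ae_restrict_mem measurableSet_Ioc).mono fun u hu => ?_
      have h2 := hu.1.le
      have h3 := sub_nonneg.2 hu.2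
      simp only [Pi.zero_apply]
      positivity
  · have h1 : ∀ u, powKernel a u * powKernel b (t - u) = 0 := by
      intro u
      unfold powKernel
      by_cases h0 : 0 < u
      · have : ¬ u < t := by linarith
        simp [this]
      · simp [h0]
    simp_rw [h1]
    simp [powKernel, ht]

/-- Translation invariance and Tonelli reduce this to the convolution of the two kernels. -/
lemma lintegral_lintegral_powKernel (a b : ℕ) {g : ℝ → ENNReal} (hg : Measurable g) :
    ∫⁻ u, powKernel a u * ∫⁻ w, powKernel b w * g (u + w) =
      ∫⁻ t, powKernel (a + b + 1) t * g t := by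
  have h1 : ∀ u, powKernel a u * ∫⁻ w, powKernel b w * g (u + w) =
      ∫⁻ t, powKernel a u * powKernel b (t - u) * g t := fun u => by
    rw [← lintegral_const_mul _ (by fun_prop),
      ← lintegral_add_left_eq_self (fun t => powKernel a u * powKernel b (t - u) * g t) u]
    simp [mul_assoc]
  simp_rw [h1]
  rw [lintegral_lintegral_swap (by fun_prop)]
  congr 1 with t
  rw [lintegral_mul_const _ (by fun_prop), lintegral_powKernel_mul_powKernel]

/-- The law of the sum of independent variables whose law is a mixture of the measures with density
`powKernel n · E`, shifted by `v`, where `E` is exponential. -/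
lemma lintegral_pi_sum_of_mixture {ι : Type*} {ν : Measure ℝ} [SigmaFinite ν] {a : ι → ENNReal}
    [Countable ι] {n : ι → ℕ} {E : ℝ → ENNReal} (hE : Measurable E)
    (hadd : ∀ s t, E (s + t) = E s * E t) {v : ℝ}
    (hν : ∀ f : ℝ → ENNReal, Measurable f →
      ∫⁻ y, f y ∂ν = ∑' i, a i * ∫⁻ u, powKernel (n i) u * (E u * f (u + v)))
    (K : ℕ) {g : ℝ → ENNReal} (hg : Measurable g) :
    ∫⁻ y, g (∑ m, y m) ∂Measure.pi (fun _ : Fin (K + 1) => ν) =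
      ∑' i : Fin (K + 1) → ι, (∏ m, a (i m)) *
        ∫⁻ t, powKernel (∑ m, n (i m) + K) t * (E t * g (t + (K + 1 : ℕ) * v)) := by
  induction K generalizing g with
  | zero =>
    have h := (measurePreserving_funUnique ν (Fin 1)).lintegral_comp hg
    simp only [MeasurableEquiv.funUnique_apply] at h
    have hs : ∀ y : Fin (0 + 1) → ℝ, ∑ m, y m = y default := fun y => by simp
    have hn : ∀ i : Fin (0 + 1) → ι, ∑ m, n (i m) = n (i default) := fun i => by simp
    have ha : ∀ i : Fin (0 + 1) → ι, ∏ m, a (i m) = a (i default) := fun i => by simp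
    simp only [hs, hn, ha, add_zero, zero_add, Nat.cast_one, one_mul] at h ⊢
    refine h.trans ?_
    rw [hν g hg, ← (Equiv.funUnique (Fin 1) ι).tsum_eq]
    rfl
  | succ K ih =>
    -- Split off coordinate `0` and apply the induction hypothesis to the test function translated
    -- by it.
    have h := ((measurePreserving_piFinSuccAbove (fun _ : Fin (K + 1 + 1) => ν) 0).symm
      ).lintegral_comp (f := fun y => g (∑ m, y m)) (by fun_prop)
    rw [← h, lintegral_prod _ ?_]
    swap
    · refine Measurable.aemeasurable ?_
      exact Measurable.comp (g := fun y : Fin (K + 1 + 1) → ℝ => g (∑ m, y m)) (by fun_prop)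
        (MeasurableEquiv.measurable _)
    have h1 : ∀ x : ℝ, ∀ y : Fin (K + 1) → ℝ,
        g (∑ m, (MeasurableEquiv.piFinSuccAbove (fun _ => ℝ) 0).symm (x, y) m) =
          g (x + ∑ m, y m) := fun x y => by
      rw [Fin.sum_univ_succ]
      rfl
    simp_rw [h1]
    have h2 : ∀ x : ℝ, ∫⁻ y, g (x + ∑ m, y m) ∂Measure.pi (fun _ : Fin (K + 1) => ν) = _ :=
      fun x => ih (g := fun s => g (x + s)) (by fun_prop)
    simp_rw [h2]
    rw [lintegral_tsum fun i => Measurable.aemeasurable <| by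
      refine Measurable.const_mul ?_ _
      exact Measurable.lintegral_prod_right' (f := fun p : ℝ × ℝ =>
        powKernel (∑ m, n (i m) + K) p.2 * (E p.2 * g (p.1 + (p.2 + (K + 1 : ℕ) * v))))
        (by fun_prop)]
    rw [← (Fin.consEquiv fun _ : Fin (K + 1 + 1) => ι).tsum_eq, ENNReal.tsum_prod',
      ENNReal.tsum_comm]
    congr 1 with i
    have hm : Measurable fun x => ∫⁻ t, powKernel (∑ m, n (i m) + K) t *
        (E t * g (x + (t + (K + 1 : ℕ) * v))) :=
      Measurable.lintegral_prod_right' (f := fun p : ℝ × ℝ =>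
        powKernel (∑ m, n (i m) + K) p.2 * (E p.2 * g (p.1 + (p.2 + (K + 1 : ℕ) * v))))
        (by fun_prop)
    rw [lintegral_const_mul _ hm, hν _ hm, ← ENNReal.tsum_mul_left]
    congr 1 with j
    have hp : ∏ m, a ((Fin.consEquiv fun _ : Fin (K + 1 + 1) => ι) (j, i) m) =
        a j * ∏ m, a (i m) := by
      rw [Fin.prod_univ_succ]
      rfl
    have hs : ∑ m, n ((Fin.consEquiv fun _ : Fin (K + 1 + 1) => ι) (j, i) m) =
        n j + ∑ m, n (i m) := by
      rw [Fin.sum_univ_succ]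
      rfl
    rw [hp, hs]
    rw [mul_left_comm, ← mul_assoc]
    congr 1
    -- Every convolution raises the exponent by one more than the sum of the two exponents, which
    -- accounts for the extra `K` in the statement.
    rw [show n j + ∑ m, n (i m) + (K + 1) = n j + (∑ m, n (i m) + K) + 1 by ring,
      ← lintegral_lintegral_powKernel (n j) (∑ m, n (i m) + K)
        (g := fun t => E t * g (t + (K + 1 + 1 : ℕ) * v)) (by fun_prop)]
    congr 1 with u
    congr 1
    rw [← lintegral_const_mul _ (by fun_prop)]
    congr 1 with t
    -- Multiplicativity of `E` lets it pass through the convolution.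
    rw [hadd, mul_left_comm (E u), ← mul_assoc (E u)]
    congr 3
    rw [show u + v + (t + (K + 1 : ℕ) * v) = u + t + (K + 1 + 1 : ℕ) * v by push_cast; ring]

/-! ### The sum of port SNRs exceeding a threshold -/

lemma hasSum_condDensity {ω μ x₀ x : ℝ} (hμ₀ : 0 ≤ μ) (hx₀ : 0 ≤ x₀) (hx : 0 ≤ x) :
    HasSum (fun k : ℕ => Real.exp (-(ω * (x + μ * x₀))) * (cCoeff ω μ k * x₀ ^ k * x ^ k))
      (condDensity ω μ x₀ x) := by
  have h := (hasSum_besselI0 (2 * ω * √(μ * x₀ * x))).mul_left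
    (ω * Real.exp (-(ω * (x + μ * x₀))))
  refine h.congr_fun fun k => ?_
  rw [mul_pow, pow_mul √_, Real.sq_sqrt (by positivity), mul_pow, mul_pow, mul_pow, cCoeff]
  field_simp
  ring

/-- Binomial theorem; the factor `k!` in `d_k = c_k k!` is the numerator of the binomial
coefficient. -/
lemma cCoeff_mul_add_pow (ω μ u v : ℝ) (k : ℕ) :
    cCoeff ω μ k * (u + v) ^ k = ∑ l ∈ Finset.range (k + 1),
      dCoeff ω μ k * (v ^ l * (1 / (l.factorial : ℝ))) *
        (u ^ (k - l) / ((k - l).factorial : ℝ)) := by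
  rw [add_comm u v, add_pow, Finset.mul_sum]
  refine Finset.sum_congr rfl fun l hl => ?_
  have hl' : l ≤ k := Nat.lt_succ_iff.1 (Finset.mem_range.1 hl)
  rw [Nat.cast_choose ℝ hl', dCoeff]
  field_simp

lemma cCoeff_nonneg {ω μ : ℝ} (hω : 0 ≤ ω) (hμ₀ : 0 ≤ μ) (k : ℕ) : 0 ≤ cCoeff ω μ k := by
  unfold cCoeff
  positivity

lemma dCoeff_nonneg {ω μ : ℝ} (hω : 0 ≤ ω) (hμ₀ : 0 ≤ μ) (k : ℕ) : 0 ≤ dCoeff ω μ k :=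
  mul_nonneg (cCoeff_nonneg hω hμ₀ k) (by positivity)

lemma rho_nonneg {ω μ : ℝ} (hω : 0 ≤ ω) (hμ₀ : 0 ≤ μ) {K : ℕ} (r : Fin K → ℕ) :
    0 ≤ rho ω μ r :=
  Finset.prod_nonneg fun _ _ => dCoeff_nonneg hω hμ₀ _

/-- The weights of the expansion of the law of a port SNR, restricted to `(v, ∞)` and shifted by
`v`, into Gamma distributions. -/
def mixtureCoeff (ω μ v x₀ : ℝ) (i : ℕ × ℕ) : ENNReal :=
  if i.2 ≤ i.1 then
    ENNReal.ofReal (Real.exp (-(ω * (v + μ * x₀))) *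
      (dCoeff ω μ i.1 * x₀ ^ i.1 * (v ^ i.2 * (1 / (i.2.factorial : ℝ)))))
  else 0

lemma mixtureCoeff_ne_top (ω μ v x₀ : ℝ) (i : ℕ × ℕ) : mixtureCoeff ω μ v x₀ i ≠ ⊤ := by
  unfold mixtureCoeff
  split_ifs <;> simp

/-- The index pair consists of the index of the Bessel series and that of the binomial expansion of
`(u + v)^k`; the weights vanish beyond the binomial range. -/
lemma tsum_mixtureCoeff {ω μ v x₀ u : ℝ} (hω : 0 ≤ ω) (hμ₀ : 0 ≤ μ) (hx₀ : 0 ≤ x₀) (hv : 0 ≤ v)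
    (hu : 0 ≤ u) :
    ∑' i : ℕ × ℕ, mixtureCoeff ω μ v x₀ i *
        (ENNReal.ofReal (u ^ (i.1 - i.2) / ((i.1 - i.2).factorial : ℝ)) *
          ENNReal.ofReal (Real.exp (-(ω * u)))) =
      ENNReal.ofReal (condDensity ω μ x₀ (u + v)) := by
  have hd := dCoeff_nonneg hω hμ₀
  have hc := cCoeff_nonneg hω hμ₀
  rw [ENNReal.tsum_prod', ← (hasSum_condDensity hμ₀ hx₀ (add_nonneg hu hv)).tsum_eq,
    ENNReal.ofReal_tsum_of_nonneg _ (hasSum_condDensity hμ₀ hx₀ (add_nonneg hu hv)).summable]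
  swap
  · intro k
    have := hc k
    positivity
  congr 1 with k
  rw [tsum_eq_sum (s := Finset.range (k + 1))]
  swap
  · intro l hl
    have : ¬ l ≤ k := fun h => hl (Finset.mem_range.2 (Nat.lt_succ_of_le h))
    simp [mixtureCoeff, this]
  rw [mul_right_comm (cCoeff ω μ k), cCoeff_mul_add_pow, Finset.sum_mul, Finset.mul_sum,
    ENNReal.ofReal_sum_of_nonneg]
  swap
  · intro l _
    have := hd k
    positivity
  refine Finset.sum_congr rfl fun l hl => ?_
  have hl' : l ≤ k := Nat.lt_succ_iff.1 (Finset.mem_range.1 hl)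
  have := hd k
  simp only [mixtureCoeff, hl', if_true]
  rw [← ENNReal.ofReal_mul (by positivity), ← ENNReal.ofReal_mul (by positivity)]
  congr 1
  rw [show -(ω * (u + v + μ * x₀)) = -(ω * (v + μ * x₀)) + -(ω * u) by ring, Real.exp_add]
  ring

lemma setLIntegral_Ioi_eq_add_right (v : ℝ) (f : ℝ → ENNReal) :
    ∫⁻ x in Set.Ioi v, f x = ∫⁻ u in Set.Ioi 0, f (u + v) := by
  rw [← lintegral_indicator measurableSet_Ioi, ← lintegral_indicator measurableSet_Ioi,
    ← lintegral_add_right_eq_self _ v]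
  congr 1 with u
  by_cases hu : 0 < u <;> simp [hu]

/-- Supplies the mixture hypothesis of `lintegral_pi_sum_of_mixture`. -/
lemma lintegral_portLaw_restrict_Ioi {ω μ v x₀ : ℝ} (hω : 0 ≤ ω) (hμ₀ : 0 ≤ μ) (hx₀ : 0 ≤ x₀)
    (hv : 0 ≤ v) {f : ℝ → ENNReal} (hf : Measurable f) :
    ∫⁻ y, f y ∂(portLaw ω μ x₀).restrict (Set.Ioi v) =
      ∑' i : ℕ × ℕ, mixtureCoeff ω μ v x₀ i * ∫⁻ u, powKernel (i.1 - i.2) u *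
        (ENNReal.ofReal (Real.exp (-(ω * u))) * f (u + v)) := by
  simp_rw [lintegral_powKernel_mul]
  simp_rw [← lintegral_const_mul' _ _ (mixtureCoeff_ne_top ω μ v x₀ _)]
  rw [← lintegral_tsum fun i => Measurable.aemeasurable (by fun_prop),
    ← lintegral_indicator measurableSet_Ioi,
    lintegral_portLaw]
  have h1 : ∀ x, ENNReal.ofReal (condDensity ω μ x₀ x) * (Set.Ioi v).indicator f x =
      (Set.Ioi v).indicator (fun x => ENNReal.ofReal (condDensity ω μ x₀ x) * f x) x :=
    fun x => by by_cases hx : v < x <;> simp [hx]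
  simp_rw [h1]
  rw [lintegral_indicator measurableSet_Ioi, Measure.restrict_restrict measurableSet_Ioi,
    Set.Ioi_inter_Ioi, sup_of_le_left hv, setLIntegral_Ioi_eq_add_right]
  refine setLIntegral_congr_fun measurableSet_Ioi fun u hu => ?_
  have hu' : 0 ≤ u := le_of_lt hu
  rw [← tsum_mixtureCoeff hω hμ₀ hx₀ hv hu', ← ENNReal.tsum_mul_right]
  congr 1 with i
  ring

/-- `sumDensity` as a series of extended nonnegative reals. -/
def sumDensityENN (ω μ : ℝ) (K : ℕ) (v x₀ x : ℝ) : ENNReal :=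
  ENNReal.ofReal (Real.exp (-(ω * (x + K * μ * x₀)))) *
    ∑' r : Fin K → ℕ, ENNReal.ofReal (sumDensityTerm ω μ v x₀ x r)

lemma mem_below {K : ℕ} {r l : Fin K → ℕ} : l ∈ below r ↔ ∀ m, l m ≤ r m := by
  simp [below]

lemma prod_mixtureCoeff {ω μ v x₀ : ℝ} (hω : 0 ≤ ω) (hμ₀ : 0 ≤ μ) (hx₀ : 0 ≤ x₀) (hv : 0 ≤ v)
    {K : ℕ} {r l : Fin K → ℕ} (hl : l ∈ below r) :
    ∏ m, mixtureCoeff ω μ v x₀ (r m, l m) =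
      ENNReal.ofReal (Real.exp (-(ω * (K * v + K * μ * x₀))) *
        (rho ω μ r * x₀ ^ (∑ m, r m) *
          (v ^ (∑ m, l m) * ∏ m, 1 / ((l m).factorial : ℝ)))) := by
  have hd := dCoeff_nonneg hω hμ₀
  simp only [mixtureCoeff, mem_below.1 hl, if_true]
  rw [← ENNReal.ofReal_prod_of_nonneg]
  · congr 1
    rw [Finset.prod_mul_distrib, Finset.prod_mul_distrib, Finset.prod_mul_distrib,
      Finset.prod_mul_distrib, Finset.prod_pow_eq_pow_sum, Finset.prod_pow_eq_pow_sum, rho,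
      Finset.prod_const, ← Real.exp_nat_mul, Finset.card_univ, Fintype.card_fin]
    congr 2
    ring
  · intro m _
    have := hd (r m)
    positivity

lemma chi_sub_one {K : ℕ} {r l : Fin (K + 1) → ℕ} (hl : l ∈ below r) :
    chi r l - 1 = ∑ m, (r m - l m) + K := by
  have h := Finset.sum_tsub_distrib Finset.univ (f := r) (g := l) fun m _ => mem_below.1 hl m
  have h2 : ∑ m, l m ≤ ∑ m, r m := Finset.sum_le_sum fun m _ => mem_below.1 hl m
  rw [h, chi]
  omega

/-- A family of pairs is regrouped into a pair of multi-indices `(r, l)`. If some `l m` exceeds `r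
m`, one factor vanishes, so only `l ∈ below r` survives. -/
lemma tsum_prod_mixtureCoeff {ω μ v x₀ t : ℝ} (hω : 0 ≤ ω) (hμ₀ : 0 ≤ μ) (hx₀ : 0 ≤ x₀)
    (hv : 0 ≤ v) (ht : 0 ≤ t) (K : ℕ) :
    ∑' i : Fin (K + 1) → ℕ × ℕ, (∏ m, mixtureCoeff ω μ v x₀ (i m)) *
        (ENNReal.ofReal (t ^ (∑ m, ((i m).1 - (i m).2) + K) /
            ((∑ m, ((i m).1 - (i m).2) + K).factorial : ℝ)) *
          ENNReal.ofReal (Real.exp (-(ω * t)))) =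
      sumDensityENN ω μ (K + 1) v x₀ (t + (K + 1 : ℕ) * v) := by
  have hd := dCoeff_nonneg hω hμ₀
  rw [← (Equiv.arrowProdEquivProdArrow (Fin (K + 1)) (fun _ => ℕ) (fun _ => ℕ)).symm.tsum_eq,
    ENNReal.tsum_prod', sumDensityENN, ← ENNReal.tsum_mul_left]
  congr 1 with r
  simp only [Equiv.arrowProdEquivProdArrow_symm_apply]
  rw [tsum_eq_sum (s := below r)]
  swap
  · intro l hl
    rw [mem_below, not_forall] at hl
    obtain ⟨m, hm⟩ := hl
    rw [Finset.prod_eq_zero (Finset.mem_univ m) (by simp [mixtureCoeff, hm]), zero_mul]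
  have hr := rho_nonneg hω hμ₀ r
  rw [← ENNReal.ofReal_mul (Real.exp_pos _).le, sumDensityTerm, Finset.mul_sum, Finset.mul_sum,
    ENNReal.ofReal_sum_of_nonneg]
  swap
  · intro l _
    rw [add_sub_cancel_right]
    positivity
  refine Finset.sum_congr rfl fun l hl => ?_
  rw [prod_mixtureCoeff hω hμ₀ hx₀ hv hl, ← ENNReal.ofReal_mul (by positivity),
    ← ENNReal.ofReal_mul (by positivity), chi_sub_one hl, add_sub_cancel_right]
  congr 1
  rw [show -(ω * (t + (K + 1 : ℕ) * v + (K + 1 : ℕ) * μ * x₀)) =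
    -(ω * ((K + 1 : ℕ) * v + (K + 1 : ℕ) * μ * x₀)) + -(ω * t) by ring, Real.exp_add]
  ring

/-- The measure of the sum of `K` port SNRs on the event that all exceed `v` has density
`sumDensityENN`. -/
lemma lintegral_pi_sum_portLaw {ω μ v x₀ : ℝ} (hω : 0 < ω) (hμ₀ : 0 ≤ μ) (hμ₁ : μ < 1)
    (hx₀ : 0 ≤ x₀) (hv : 0 ≤ v) {K : ℕ} (hK : 1 ≤ K) {g : ℝ → ENNReal} (hg : Measurable g) :
    ∫⁻ y, g (∑ m, y m) ∂Measure.pi (fun _ : Fin K => (portLaw ω μ x₀).restrict (Set.Ioi v)) =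
      ∫⁻ x in Set.Ioi (K * v), sumDensityENN ω μ K v x₀ x * g x := by
  obtain ⟨K, rfl⟩ := Nat.exists_eq_add_of_le' hK
  have := isProbabilityMeasure_portLaw hω hμ₀ hμ₁ hx₀
  rw [lintegral_pi_sum_of_mixture (n := fun i : ℕ × ℕ => i.1 - i.2)
    (E := fun u => ENNReal.ofReal (Real.exp (-(ω * u)))) (by fun_prop)
    (fun s t => by
      rw [← ENNReal.ofReal_mul (Real.exp_pos _).le, ← Real.exp_add]
      ring_nf)
    (fun f hf => lintegral_portLaw_restrict_Ioi hω.le hμ₀ hx₀ hv hf) K hg,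
    setLIntegral_Ioi_eq_add_right]
  simp_rw [lintegral_powKernel_mul]
  have hne : ∀ i : Fin (K + 1) → ℕ × ℕ, ∏ m, mixtureCoeff ω μ v x₀ (i m) ≠ ⊤ := fun i =>
    ENNReal.prod_ne_top fun m _ => mixtureCoeff_ne_top ω μ v x₀ _
  simp_rw [← lintegral_const_mul' _ _ (hne _)]
  rw [← lintegral_tsum fun i => Measurable.aemeasurable (by fun_prop)]
  refine setLIntegral_congr_fun measurableSet_Ioi fun t ht => ?_
  have ht' : 0 ≤ t := le_of_lt ht
  rw [← tsum_prod_mixtureCoeff hω.le hμ₀ hx₀ hv ht', ← ENNReal.tsum_mul_right]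
  congr 1 with i
  ring

/-! ### Convergence and termwise integration of the multi-series -/

lemma sumDensityTerm_nonneg {ω μ v x₀ x : ℝ} (hω : 0 ≤ ω) (hμ₀ : 0 ≤ μ) (hx₀ : 0 ≤ x₀)
    (hv : 0 ≤ v) {K : ℕ} (hx : K * v ≤ x) (r : Fin K → ℕ) :
    0 ≤ sumDensityTerm ω μ v x₀ x r := by
  have hr := rho_nonneg hω hμ₀ r
  have hx' := sub_nonneg.2 hx
  unfold sumDensityTerm
  positivity

lemma sumDensityTerm_mono {ω μ v x₀ x y : ℝ} (hω : 0 ≤ ω) (hμ₀ : 0 ≤ μ) (hx₀ : 0 ≤ x₀)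
    (hv : 0 ≤ v) {K : ℕ} (hx : K * v ≤ x) (hxy : x ≤ y) (r : Fin K → ℕ) :
    sumDensityTerm ω μ v x₀ x r ≤ sumDensityTerm ω μ v x₀ y r := by
  have hr := rho_nonneg hω hμ₀ r
  have hx' := sub_nonneg.2 hx
  unfold sumDensityTerm
  gcongr

@[fun_prop]
lemma continuous_sumDensityTerm (ω μ v x₀ : ℝ) {K : ℕ} (r : Fin K → ℕ) :
    Continuous fun x => sumDensityTerm ω μ v x₀ x r := by
  unfold sumDensityTerm
  fun_prop

@[fun_prop]
lemma measurable_sumDensityENN (ω μ : ℝ) (K : ℕ) (v x₀ : ℝ) :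
    Measurable (sumDensityENN ω μ K v x₀) := by
  unfold sumDensityENN
  refine Measurable.mul (by fun_prop) (Measurable.tsum fun r => ?_)
  exact (continuous_sumDensityTerm ω μ v x₀ r).measurable.ennreal_ofReal

/-- The integral is the probability that all `K` ports exceed `v`. Every convergence statement below
rests on this bound. -/
lemma lintegral_sumDensityENN_le_one {ω μ v x₀ : ℝ} (hω : 0 < ω) (hμ₀ : 0 ≤ μ) (hμ₁ : μ < 1)
    (hx₀ : 0 ≤ x₀) (hv : 0 ≤ v) {K : ℕ} (hK : 1 ≤ K) :
    ∫⁻ x in Set.Ioi (K * v), sumDensityENN ω μ K v x₀ x ≤ 1 := by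
  have := isProbabilityMeasure_portLaw hω hμ₀ hμ₁ hx₀
  have h := lintegral_pi_sum_portLaw hω hμ₀ hμ₁ hx₀ hv hK (g := fun _ => 1) measurable_const
  simp only [mul_one] at h
  rw [← h, lintegral_one, Measure.pi_univ]
  exact Finset.prod_le_one' fun m _ => by
    rw [Measure.restrict_apply_univ]
    exact prob_le_one

lemma summable_of_tsum_ofReal_ne_top {ι : Type*} {f : ι → ℝ} (hf : ∀ i, 0 ≤ f i)
    (h : ∑' i, ENNReal.ofReal (f i) ≠ ⊤) : Summable f := by
  have h2 := ENNReal.summable_toReal h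
  simpa only [ENNReal.toReal_ofReal (hf _)] using h2

/-- A finite integral gives convergence only almost everywhere. Since the terms increase in `x`,
convergence at a single point beyond `x` suffices. -/
lemma summable_sumDensityTerm {ω μ v x₀ x : ℝ} (hω : 0 < ω) (hμ₀ : 0 ≤ μ) (hμ₁ : μ < 1)
    (hx₀ : 0 ≤ x₀) (hv : 0 ≤ v) {K : ℕ} (hK : 1 ≤ K) (hx : K * v ≤ x) :
    Summable fun r : Fin K → ℕ => sumDensityTerm ω μ v x₀ x r := by
  have hle := lintegral_sumDensityENN_le_one hω hμ₀ hμ₁ hx₀ hv hK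
  have hae := ae_lt_top (measurable_sumDensityENN ω μ K v x₀) (ne_top_of_le_ne_top (by simp) hle)
  have hae2 : ∀ᵐ y ∂volume.restrict (Set.Ioi x), sumDensityENN ω μ K v x₀ y < ⊤ :=
    ae_mono (Measure.restrict_mono (Set.Ioi_subset_Ioi hx) le_rfl) hae
  have hne : (ae (volume.restrict (Set.Ioi x))).NeBot := by
    rw [ae_neBot, Ne, Measure.restrict_eq_zero]
    simp
  obtain ⟨y, hy, hxy⟩ := (hae2.and (ae_restrict_mem measurableSet_Ioi)).exists
  have hxy' : x ≤ y := le_of_lt hxy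
  have hsum : Summable fun r : Fin K → ℕ => sumDensityTerm ω μ v x₀ y r := by
    refine summable_of_tsum_ofReal_ne_top
      (sumDensityTerm_nonneg hω.le hμ₀ hx₀ hv (hx.trans hxy')) fun h => ?_
    rw [sumDensityENN, h, ENNReal.mul_top] at hy
    · exact lt_irrefl _ hy
    · simp [Real.exp_pos]
  exact hsum.of_nonneg_of_le (sumDensityTerm_nonneg hω.le hμ₀ hx₀ hv hx)
    (sumDensityTerm_mono hω.le hμ₀ hx₀ hv hx hxy')

lemma sumDensity_nonneg {ω μ v x₀ x : ℝ} (hω : 0 ≤ ω) (hμ₀ : 0 ≤ μ) (hx₀ : 0 ≤ x₀)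
    (hv : 0 ≤ v) {K : ℕ} (hx : K * v ≤ x) : 0 ≤ sumDensity ω μ K v x₀ x :=
  mul_nonneg (Real.exp_pos _).le
    (tsum_nonneg fun r => sumDensityTerm_nonneg hω hμ₀ hx₀ hv hx r)

lemma ofReal_sumDensity {ω μ v x₀ x : ℝ} (hω : 0 < ω) (hμ₀ : 0 ≤ μ) (hμ₁ : μ < 1)
    (hx₀ : 0 ≤ x₀) (hv : 0 ≤ v) {K : ℕ} (hK : 1 ≤ K) (hx : K * v ≤ x) :
    ENNReal.ofReal (sumDensity ω μ K v x₀ x) = sumDensityENN ω μ K v x₀ x := by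
  rw [sumDensity, sumDensityENN, ENNReal.ofReal_mul (Real.exp_pos _).le,
    ENNReal.ofReal_tsum_of_nonneg (sumDensityTerm_nonneg hω.le hμ₀ hx₀ hv hx)
      (summable_sumDensityTerm hω hμ₀ hμ₁ hx₀ hv hK hx)]

lemma integrableOn_sumDensity {ω μ v x₀ : ℝ} (hω : 0 < ω) (hμ₀ : 0 ≤ μ) (hμ₁ : μ < 1)
    (hx₀ : 0 ≤ x₀) (hv : 0 ≤ v) {K : ℕ} (hK : 1 ≤ K) :
    IntegrableOn (sumDensity ω μ K v x₀) (Set.Ioi (K * v)) := by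
  have hle := lintegral_sumDensityENN_le_one hω hμ₀ hμ₁ hx₀ hv hK
  have h := integrable_toReal_of_lintegral_ne_top
    (measurable_sumDensityENN ω μ K v x₀).aemeasurable (ne_top_of_le_ne_top (by simp) hle)
  refine h.congr ((ae_restrict_mem measurableSet_Ioi).mono fun x hx => ?_)
  have hx' := (Set.mem_Ioi.1 hx).le
  simp only
  rw [← ofReal_sumDensity hω hμ₀ hμ₁ hx₀ hv hK hx',
    ENNReal.toReal_ofReal (sumDensity_nonneg hω.le hμ₀ hx₀ hv hx')]

lemma ofReal_integral_sumDensity {ω μ v x₀ x : ℝ} (hω : 0 < ω) (hμ₀ : 0 ≤ μ) (hμ₁ : μ < 1)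
    (hx₀ : 0 ≤ x₀) (hv : 0 ≤ v) {K : ℕ} (hK : 1 ≤ K) (hx : K * v ≤ x) :
    ENNReal.ofReal (∫ t in (K * v)..x, sumDensity ω μ K v x₀ t) =
      ∫⁻ t in Set.Ioc (K * v) x, sumDensityENN ω μ K v x₀ t := by
  rw [intervalIntegral.integral_of_le hx, ofReal_integral_eq_lintegral_ofReal]
  · exact setLIntegral_congr_fun measurableSet_Ioc fun t ht =>
      ofReal_sumDensity hω hμ₀ hμ₁ hx₀ hv hK ht.1.le
  · exact (integrableOn_sumDensity hω hμ₀ hμ₁ hx₀ hv hK).mono_set Set.Ioc_subset_Ioi_self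
  · exact (ae_restrict_mem measurableSet_Ioc).mono fun t ht =>
      sumDensity_nonneg hω.le hμ₀ hx₀ hv ht.1.le

/-- The affine substitution `t ↦ ωt - ωs` produces the incomplete Gamma function. -/
lemma integral_exp_mul_pow {ω : ℝ} (hω : 0 < ω) (s x : ℝ) (n : ℕ) :
    ∫ t in s..x, Real.exp (-(ω * t)) * ((t - s) ^ n / (n.factorial : ℝ)) =
      Real.exp (-(ω * s)) *
        (lowerGamma ((n + 1 : ℕ) : ℝ) (ω * (x - s)) / ((n.factorial : ℝ) * ω ^ (n + 1))) := by
  have h := intervalIntegral.integral_comp_mul_sub (a := s) (b := x)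
    (fun t => Real.exp (-t) * t ^ n) hω.ne' (ω * s)
  have h2 : ∀ t, Real.exp (-(ω * t - ω * s)) * (ω * t - ω * s) ^ n =
      Real.exp (ω * s) * n.factorial * ω ^ n *
        (Real.exp (-(ω * t)) * ((t - s) ^ n / (n.factorial : ℝ))) := fun t => by
    rw [← mul_sub, mul_pow, mul_sub, show -(ω * t - ω * s) = ω * s + -(ω * t) by ring,
      Real.exp_add]
    field_simp
  simp_rw [h2] at h
  rw [intervalIntegral.integral_const_mul, sub_self, ← mul_sub, smul_eq_mul] at h
  have h3 : lowerGamma ((n + 1 : ℕ) : ℝ) (ω * (x - s)) =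
      ∫ t in (0 : ℝ)..ω * (x - s), Real.exp (-t) * t ^ n := by
    unfold lowerGamma
    congr 1 with t
    rw [← Real.rpow_natCast]
    push_cast
    rw [add_sub_cancel_right]
  rw [← h3] at h
  rw [Real.exp_neg]
  field_simp
  field_simp at h
  rw [pow_succ]
  linear_combination h

lemma integral_exp_mul_sumDensityTerm {ω μ v x₀ x : ℝ} (hω : 0 < ω) {K : ℕ}
    (hK : 1 ≤ K) (r : Fin K → ℕ) :
    ∫ t in (K * v)..x, Real.exp (-(ω * t)) * sumDensityTerm ω μ v x₀ t r =
      Real.exp (-(ω * (K * v))) * phiTerm ω μ x v x₀ r := by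
  unfold sumDensityTerm phiTerm
  have h1 : ∀ t, Real.exp (-(ω * t)) * (rho ω μ r * x₀ ^ (∑ m, r m) *
      ∑ l ∈ below r, v ^ (∑ m, l m) * (∏ m, 1 / ((l m).factorial : ℝ)) *
        ((t - K * v) ^ (chi r l - 1) / ((chi r l - 1).factorial : ℝ))) =
      rho ω μ r * x₀ ^ (∑ m, r m) *
      ∑ l ∈ below r, v ^ (∑ m, l m) * (∏ m, 1 / ((l m).factorial : ℝ)) *
        (Real.exp (-(ω * t)) *
          ((t - K * v) ^ (chi r l - 1) / ((chi r l - 1).factorial : ℝ))) := fun t => by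
    rw [mul_left_comm, Finset.mul_sum]
    simp only [mul_left_comm]
  simp_rw [h1]
  rw [intervalIntegral.integral_const_mul, intervalIntegral.integral_finsetSum
    fun l _ => Continuous.intervalIntegrable (by fun_prop) _ _, mul_left_comm]
  congr 1
  rw [Finset.mul_sum]
  refine Finset.sum_congr rfl fun l hl => ?_
  obtain ⟨K, rfl⟩ := Nat.exists_eq_add_of_le' hK
  -- Since `l ≤ r` and there is at least one port, `chi r l ≥ 1` and the truncated subtraction is
  -- exact.
  have hchi : chi r l - 1 + 1 = chi r l := by
    refine Nat.sub_add_cancel ?_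
    have h2 : ∑ m, l m ≤ ∑ m, r m := Finset.sum_le_sum fun m _ => mem_below.1 hl m
    rw [chi]
    omega
  rw [intervalIntegral.integral_const_mul, integral_exp_mul_pow hω, hchi]
  ring

lemma phiTerm_nonneg {ω μ v x₀ x : ℝ} (hω : 0 < ω) (hμ₀ : 0 ≤ μ) (hx₀ : 0 ≤ x₀)
    (hv : 0 ≤ v) {K : ℕ} (hK : 1 ≤ K) (hx : K * v ≤ x) (r : Fin K → ℕ) :
    0 ≤ phiTerm ω μ x v x₀ r := by
  have h : 0 ≤ Real.exp (-(ω * (K * v))) * phiTerm ω μ x v x₀ r := by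
    rw [← integral_exp_mul_sumDensityTerm hω hK r]
    exact intervalIntegral.integral_nonneg hx fun t ht =>
      mul_nonneg (Real.exp_pos _).le (sumDensityTerm_nonneg hω.le hμ₀ hx₀ hv ht.1 r)
  exact nonneg_of_mul_nonneg_right h (Real.exp_pos _)

/-- Tonelli on the series of densities. Integrating `e^{-ωt}` against a shifted monomial leaves the
factor `e^{-ωKv}` in front. -/
lemma tsum_ofReal_phiTerm {ω μ v x₀ x : ℝ} (hω : 0 < ω) (hμ₀ : 0 ≤ μ)
    (hx₀ : 0 ≤ x₀) (hv : 0 ≤ v) {K : ℕ} (hK : 1 ≤ K) (hx : K * v ≤ x) :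
    ENNReal.ofReal (Real.exp (-(ω * (K * v + K * μ * x₀)))) *
        ∑' r : Fin K → ℕ, ENNReal.ofReal (phiTerm ω μ x v x₀ r) =
      ∫⁻ t in Set.Ioc (K * v) x, sumDensityENN ω μ K v x₀ t := by
  unfold sumDensityENN
  simp_rw [← ENNReal.tsum_mul_left]
  rw [lintegral_tsum fun r => Measurable.aemeasurable <| by
    have := (continuous_sumDensityTerm ω μ v x₀ r).measurable
    fun_prop]
  congr 1 with r
  have h1 : Real.exp (-(ω * (K * v + K * μ * x₀))) * phiTerm ω μ x v x₀ r =
      ∫ t in (K * v)..x, Real.exp (-(ω * (t + K * μ * x₀))) * sumDensityTerm ω μ v x₀ t r := by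
    have h2 : ∀ t, Real.exp (-(ω * (t + K * μ * x₀))) * sumDensityTerm ω μ v x₀ t r =
        Real.exp (-(ω * (K * μ * x₀))) *
          (Real.exp (-(ω * t)) * sumDensityTerm ω μ v x₀ t r) := fun t => by
      rw [← mul_assoc, ← Real.exp_add]
      ring_nf
    simp_rw [h2]
    rw [intervalIntegral.integral_const_mul, integral_exp_mul_sumDensityTerm hω hK r,
      ← mul_assoc, ← Real.exp_add]
    ring_nf
  rw [← ENNReal.ofReal_mul (Real.exp_pos _).le, h1, intervalIntegral.integral_of_le hx,
    ofReal_integral_eq_lintegral_ofReal]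
  · simp_rw [ENNReal.ofReal_mul (Real.exp_pos _).le]
  · have := continuous_sumDensityTerm ω μ v x₀ r
    exact (Continuous.integrableOn_Icc (by fun_prop)).mono_set Set.Ioc_subset_Icc_self
  · exact (ae_restrict_mem measurableSet_Ioc).mono fun t ht =>
      mul_nonneg (Real.exp_pos _).le (sumDensityTerm_nonneg hω.le hμ₀ hx₀ hv ht.1.le r)

lemma summable_phiTerm {ω μ v x₀ x : ℝ} (hω : 0 < ω) (hμ₀ : 0 ≤ μ) (hμ₁ : μ < 1)
    (hx₀ : 0 ≤ x₀) (hv : 0 ≤ v) {K : ℕ} (hK : 1 ≤ K) (hx : K * v ≤ x) :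
    Summable fun r : Fin K → ℕ => phiTerm ω μ x v x₀ r := by
  refine summable_of_tsum_ofReal_ne_top (phiTerm_nonneg hω hμ₀ hx₀ hv hK hx) fun h => ?_
  have h2 := tsum_ofReal_phiTerm (x := x) hω hμ₀ hx₀ hv hK hx
  have h3 := (lintegral_mono_set (Set.Ioc_subset_Ioi_self (a := x))).trans
    (lintegral_sumDensityENN_le_one hω hμ₀ hμ₁ hx₀ hv hK)
  rw [← h2, h, ENNReal.mul_top (by simp [Real.exp_pos])] at h3
  exact absurd h3 (by simp)

lemma Phi_nonneg {ω μ x₀ v : ℝ} (hω : 0 < ω) (hμ₀ : 0 ≤ μ) (hx₀ : 0 ≤ x₀)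
    (hv : 0 ≤ v) {K : ℕ} (hK : 1 ≤ K) (x : ℝ) : 0 ≤ Phi ω μ K x v x₀ := by
  unfold Phi
  split_ifs with hx
  · exact mul_nonneg (Real.exp_pos _).le (tsum_nonneg (phiTerm_nonneg hω hμ₀ hx₀ hv hK hx))
  · exact le_rfl

/-- Valid for every real `x`: below `K v` the interval is empty and `Phi` is zero by definition. -/
lemma ofReal_Phi {ω μ v x₀ : ℝ} (hω : 0 < ω) (hμ₀ : 0 ≤ μ) (hμ₁ : μ < 1)
    (hx₀ : 0 ≤ x₀) (hv : 0 ≤ v) {K : ℕ} (hK : 1 ≤ K) (x : ℝ) :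
    ENNReal.ofReal (Phi ω μ K x v x₀) =
      ∫⁻ t in Set.Ioc (K * v) x, sumDensityENN ω μ K v x₀ t := by
  unfold Phi
  split_ifs with hx
  · rw [← tsum_ofReal_phiTerm hω hμ₀ hx₀ hv hK hx, ENNReal.ofReal_mul (Real.exp_pos _).le,
      ENNReal.ofReal_tsum_of_nonneg (phiTerm_nonneg hω hμ₀ hx₀ hv hK hx)
        (summable_phiTerm hω hμ₀ hμ₁ hx₀ hv hK hx)]
  · rw [Set.Ioc_eq_empty (fun h => hx h.le)]
    simp

lemma Phi_eq_integral {ω μ v x₀ x : ℝ} (hω : 0 < ω) (hμ₀ : 0 ≤ μ) (hμ₁ : μ < 1)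
    (hx₀ : 0 ≤ x₀) (hv : 0 ≤ v) {K : ℕ} (hK : 1 ≤ K) (hx : K * v ≤ x) :
    Phi ω μ K x v x₀ = ∫ t in (K * v)..x, sumDensity ω μ K v x₀ t := by
  rw [← ENNReal.toReal_ofReal (Phi_nonneg hω hμ₀ hx₀ hv hK x),
    ofReal_Phi hω hμ₀ hμ₁ hx₀ hv hK x, ← ofReal_integral_sumDensity hω hμ₀ hμ₁ hx₀ hv hK hx,
    ENNReal.toReal_ofReal]
  exact intervalIntegral.integral_nonneg hx fun t ht => sumDensity_nonneg hω.le hμ₀ hx₀ hv ht.1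

/-- Distinct coordinates stay independent; this passes from all ports to a selected set of them. -/
lemma pi_map_comp_injective {ι κ : Type*} [Fintype ι] [Fintype κ] {ν : Measure ℝ}
    [IsProbabilityMeasure ν] {f : κ → ι} (hf : Function.Injective f) :
    (Measure.pi fun _ : ι => ν).map (fun y k => y (f k)) = Measure.pi fun _ : κ => ν := by
  have h := (iIndepFun_pi (μ := fun _ : ι => ν) (X := fun _ x => x)
    fun _ => aemeasurable_id).precomp hf
  rw [iIndepFun_iff_map_fun_eq_pi_map fun k => (measurable_pi_apply (f k)).aemeasurable] at h
  refine h.trans ?_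
  congr 1 with k : 1
  exact (measurePreserving_eval _ (f k)).map_eq

/-- The probability that the `K` ports in `S` have SNR above `v` and SNR sum at most `x`, given the
reference SNR. -/
lemma pi_portLaw_lt_and_sum_le {ω μ v x₀ : ℝ} (hω : 0 < ω) (hμ₀ : 0 ≤ μ) (hμ₁ : μ < 1)
    (hx₀ : 0 ≤ x₀) (hv : 0 ≤ v) {K : ℕ} (hK : 1 ≤ K) (x : ℝ) {M : ℕ} {S : Finset (Fin M)}
    (hS : S.card = K) :
    (Measure.pi fun _ : Fin M => portLaw ω μ x₀) {y | (∀ m ∈ S, v < y m) ∧ ∑ m ∈ S, y m ≤ x} =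
      ENNReal.ofReal (Phi ω μ K x v x₀) := by
  have := isProbabilityMeasure_portLaw hω hμ₀ hμ₁ hx₀
  have hmeas : MeasurableSet {u : Fin K → ℝ | ∑ k, u k ≤ x} :=
    measurableSet_le (by fun_prop) measurable_const
  have hpi : MeasurableSet (Set.univ.pi fun _ : Fin K => Set.Ioi v) :=
    MeasurableSet.univ_pi fun _ => measurableSet_Ioi
  have hset : {y : Fin M → ℝ | (∀ m ∈ S, v < y m) ∧ ∑ m ∈ S, y m ≤ x} =
      (fun y k => y (S.orderEmbOfFin hS k)) ⁻¹'
        ({u : Fin K → ℝ | ∑ k, u k ≤ x} ∩ Set.univ.pi fun _ => Set.Ioi v) := by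
    ext y
    have hsum : ∑ m ∈ S, y m = ∑ k, y (S.orderEmbOfFin hS k) := by
      conv_lhs => rw [← Finset.map_orderEmbOfFin_univ S hS]
      exact Finset.sum_map _ _ _
    have hall : (∀ m ∈ S, v < y m) ↔ ∀ k, v < y (S.orderEmbOfFin hS k) := by
      rw [← Set.forall_mem_range (p := fun m => v < y m), Finset.range_orderEmbOfFin]
      simp
    simp [hsum, hall, and_comm]
  rw [hset, ← Measure.map_apply (by fun_prop) (hmeas.inter hpi),
    pi_map_comp_injective (S.orderEmbOfFin hS).injective, ofReal_Phi hω hμ₀ hμ₁ hx₀ hv hK,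
    -- The restriction of a product measure to a box is the product of the restrictions, to which
    -- the convolution formula applies.
    ← Measure.restrict_apply hmeas, Measure.restrict_pi_pi]
  have h := lintegral_pi_sum_portLaw hω hμ₀ hμ₁ hx₀ hv hK
    (g := (Set.Iic x).indicator 1) (measurable_one.indicator measurableSet_Iic)
  have h1 : ∀ y : Fin K → ℝ, (Set.Iic x).indicator (1 : ℝ → ENNReal) (∑ m, y m) =
      {u : Fin K → ℝ | ∑ k, u k ≤ x}.indicator 1 y := fun y => by
    simp [Set.indicator]
  have h2 : ∀ t, sumDensityENN ω μ K v x₀ t * (Set.Iic x).indicator (1 : ℝ → ENNReal) t =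
      (Set.Iic x).indicator (sumDensityENN ω μ K v x₀) t := fun t => by
    by_cases ht : t ≤ x <;> simp [ht]
  simp_rw [h1, h2] at h
  rw [lintegral_indicator_one hmeas, lintegral_indicator measurableSet_Iic,
    Measure.restrict_restrict measurableSet_Iic, Set.inter_comm, Set.Ioi_inter_Iic] at h
  exact h

/-! ### Order statistics -/

/-- Replacing one coordinate by an independent copy preserves a product measure. -/
lemma measurePreserving_update {ι : Type*} [Fintype ι] [DecidableEq ι] (ν : Measure ℝ)
    [IsProbabilityMeasure ν] (j : ι) :
    MeasurePreserving (fun p : ℝ × (ι → ℝ) => Function.update p.2 j p.1)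
      (ν.prod (Measure.pi fun _ => ν)) (Measure.pi fun _ => ν) := by
  have hm : Measurable fun p : ℝ × (ι → ℝ) => Function.update p.2 j p.1 := by
    rw [measurable_pi_iff]
    intro i
    by_cases h : i = j
    · subst h
      simpa using measurable_fst
    · simp only [Function.update_of_ne h]
      fun_prop
  refine ⟨hm, (Measure.pi_eq fun s hs => ?_).symm⟩
  rw [Measure.map_apply hm (MeasurableSet.univ_pi hs)]
  -- The preimage of a box is a box: side `j` constrains the fresh variable and the old coordinate
  -- `j` becomes free.
  have hset : (fun p : ℝ × (ι → ℝ) => Function.update p.2 j p.1) ⁻¹' Set.univ.pi s =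
      s j ×ˢ Set.univ.pi (Function.update s j Set.univ) := by
    ext p
    simp only [Set.mem_preimage, Set.mem_univ_pi, Set.mem_prod]
    constructor
    · refine fun h => ⟨by simpa using h j, fun i => ?_⟩
      by_cases hi : i = j
      · subst hi; simp
      · simpa [hi] using h i
    · rintro ⟨h1, h2⟩ i
      by_cases hi : i = j
      · subst hi; simpa using h1
      · simpa [hi] using h2 i
  rw [hset, Measure.prod_prod, Measure.pi_pi, ← Finset.mul_prod_erase _ _ (Finset.mem_univ j)]
  conv_rhs => rw [← Finset.mul_prod_erase _ _ (Finset.mem_univ j)]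
  rw [Function.update_self, measure_univ, one_mul]
  congr 1
  refine Finset.prod_congr rfl fun i hi => ?_
  rw [Function.update_of_ne (Finset.ne_of_mem_erase hi)]

/-- Resample coordinate `i`: given the others, it equals `y j` with probability zero because `ν` has
no atoms. -/
lemma ae_injective_pi {M : ℕ} (ν : Measure ℝ) [IsProbabilityMeasure ν] [NullSingletonClass ν] :
    ∀ᵐ y ∂Measure.pi fun _ : Fin M => ν, Function.Injective y := by
  have h : ∀ i j : Fin M, i ≠ j → ∀ᵐ y ∂Measure.pi fun _ : Fin M => ν, y i ≠ y j := by
    intro i j hij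
    have hms : MeasurableSet {y : Fin M → ℝ | y i ≠ y j} :=
      (measurableSet_eq_fun (measurable_pi_apply i) (measurable_pi_apply j)).compl
    rw [← (measurePreserving_update ν i).map_eq, ae_map_iff
      (measurePreserving_update ν i).measurable.aemeasurable hms]
    simp only [Function.update_self, Function.update_of_ne hij.symm]
    have hm : MeasurableSet {p : ℝ × (Fin M → ℝ) | p.1 = p.2 j} :=
      measurableSet_eq_fun (by fun_prop) (by fun_prop)
    rw [ae_iff]
    simp only [not_not]
    rw [Measure.prod_apply_symm hm]
    simp [Set.preimage]
  have h2 : ∀ᵐ y ∂Measure.pi fun _ : Fin M => ν, ∀ i j : Fin M, i ≠ j → y i ≠ y j := by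
    simp only [ae_all_iff]
    exact h
  exact h2.mono fun y hy i j hij => by_contra fun hne => hy i j hne hij

/-- The event that the ports in `S` are above port `j`, the other ports are not, and the sum over
`S` is at most `z`. -/
def orderEvent {M : ℕ} (z : ℝ) (S : Finset (Fin M)) (j : Fin M) : Set (Fin M → ℝ) :=
  {y | ((∀ i ∈ S, y j < y i) ∧ ∑ i ∈ S, y i ≤ z) ∧ ∀ i ∈ Sᶜ.erase j, y i ≤ y j}

lemma measurableSet_orderEvent {M : ℕ} (z : ℝ) (S : Finset (Fin M)) (j : Fin M) :
    MeasurableSet (orderEvent z S j) := by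
  unfold orderEvent
  measurability

lemma pi_inter_disjoint {M : ℕ} (ν : Measure ℝ) [IsProbabilityMeasure ν] (z v : ℝ)
    {S T : Finset (Fin M)} (hST : Disjoint S T) :
    (Measure.pi fun _ : Fin M => ν)
        {y | ((∀ i ∈ S, v < y i) ∧ ∑ i ∈ S, y i ≤ z) ∧ ∀ i ∈ T, y i ≤ v} =
      (Measure.pi fun _ : Fin M => ν) {y | (∀ i ∈ S, v < y i) ∧ ∑ i ∈ S, y i ≤ z} *
        (Measure.pi fun _ : Fin M => ν) {y | ∀ i ∈ T, y i ≤ v} := by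
  have h := (iIndepFun_pi (μ := fun _ : Fin M => ν) (X := fun _ x => x)
    fun _ => aemeasurable_id).indepFun_finset S T hST fun i => measurable_pi_apply i
  have hA : MeasurableSet {w : S → ℝ | (∀ i, v < w i) ∧ ∑ i, w i ≤ z} := by measurability
  have hB : MeasurableSet {w : T → ℝ | ∀ i, w i ≤ v} := by measurability
  have h2 := h.measure_inter_preimage_eq_mul _ _ hA hB
  have hAe : (fun (y : Fin M → ℝ) (i : S) => y i) ⁻¹'
      {w : S → ℝ | (∀ i, v < w i) ∧ ∑ i, w i ≤ z} =
      {y | (∀ i ∈ S, v < y i) ∧ ∑ i ∈ S, y i ≤ z} := by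
    ext y
    have hsum := Finset.sum_coe_sort S y
    simp only [Set.mem_preimage, Set.mem_ofPred_eq, Subtype.forall, hsum]
  have hBe : (fun (y : Fin M → ℝ) (i : T) => y i) ⁻¹' {w : T → ℝ | ∀ i, w i ≤ v} =
      {y | ∀ i ∈ T, y i ≤ v} := by
    ext y
    simp
  rw [hAe, hBe] at h2
  exact h2

/-- Resampling coordinate `j` amounts to conditioning on its value `v`; the constraints on `S` and
on the remaining ports then involve disjoint blocks. -/
lemma pi_orderEvent {M : ℕ} (ν : Measure ℝ) [IsProbabilityMeasure ν] (z : ℝ)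
    {S : Finset (Fin M)} {j : Fin M} (hj : j ∈ Sᶜ) :
    (Measure.pi fun _ : Fin M => ν) (orderEvent z S j) =
      ∫⁻ v, (Measure.pi fun _ : Fin M => ν) {y | (∀ i ∈ S, v < y i) ∧ ∑ i ∈ S, y i ≤ z} *
        (Measure.pi fun _ : Fin M => ν) {y | ∀ i ∈ Sᶜ.erase j, y i ≤ v} ∂ν := by
  have hjS : j ∉ S := Finset.mem_compl.1 hj
  have hm := measurableSet_orderEvent z S j
  have hp := measurePreserving_update ν j
  rw [← hp.measure_preimage hm.nullMeasurableSet, Measure.prod_apply (hp.measurable hm)]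
  congr 1 with v
  rw [← pi_inter_disjoint ν z v (disjoint_compl_right.mono_right (Finset.erase_subset j _))]
  congr 1
  ext y
  have h1 : ∀ i ∈ S, Function.update y j v i = y i := fun i hi =>
    Function.update_of_ne (fun h : i = j => hjS (h ▸ hi)) _ _
  have h2 : ∀ i ∈ Sᶜ.erase j, Function.update y j v i = y i := fun i hi =>
    Function.update_of_ne (Finset.ne_of_mem_erase hi) _ _
  simp only [Set.mem_preimage, orderEvent, Set.mem_ofPred_eq, Function.update_self]
  rw [Finset.sum_congr rfl h1, forall₂_congr fun i hi => by rw [h1 i hi],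
    forall₂_congr (p := fun i _ => Function.update y j v i ≤ v) fun i hi => by rw [h2 i hi]]

/-- If the sets differ, equal cardinality gives `i ∈ S \ S'` and `j ∈ S' \ S`. Each dominates the
other, so they tie, against injectivity. -/
lemma IsTopK.unique {M K : ℕ} {y : Fin M → ℝ} (hy : Function.Injective y) {S S' : Finset (Fin M)}
    (h : IsTopK K y S) (h' : IsTopK K y S') : S = S' := by
  refine Finset.eq_of_subset_of_card_le (fun i hi => by_contra fun hi' => ?_)
    (h'.1.trans h.1.symm).le
  have hns : ¬ S' ⊆ S := fun hs =>
    hi' ((Finset.eq_of_subset_of_card_le hs (h.1.trans h'.1.symm).le).symm ▸ hi)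
  obtain ⟨j, hj', hj⟩ := Finset.not_subset.1 hns
  have hij := hy (le_antisymm (h'.2 j hj' i hi') (h.2 i hi j hj))
  exact hj (hij ▸ hi)

lemma isTopK_of_mem_orderEvent {M : ℕ} {z : ℝ} {S : Finset (Fin M)} {j : Fin M} {y : Fin M → ℝ}
    (hy : y ∈ orderEvent z S j) : IsTopK S.card y S := by
  refine ⟨rfl, fun i hi k hk => ?_⟩
  by_cases hkj : k = j
  · exact hkj ▸ (hy.1.1 i hi).le
  · exact (hy.2 k (Finset.mem_erase.2 ⟨hkj, Finset.mem_compl.2 hk⟩)).trans (hy.1.1 i hi).le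

lemma orderEvent_index_unique {M K : ℕ} {z : ℝ} {S S' : Finset (Fin M)} {j j' : Fin M}
    {y : Fin M → ℝ} (hy : Function.Injective y) (hS : S.card = K) (hS' : S'.card = K)
    (hj : j ∈ Sᶜ) (hj' : j' ∈ S'ᶜ) (h : y ∈ orderEvent z S j) (h' : y ∈ orderEvent z S' j') :
    S = S' ∧ j = j' := by
  have hSS : S = S' := (isTopK_of_mem_orderEvent h).unique hy
    (by rw [hS, ← hS']; exact isTopK_of_mem_orderEvent h')
  subst hSS
  refine ⟨rfl, by_contra fun hne => hne (hy (le_antisymm ?_ ?_))⟩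
  · exact h'.2 j (Finset.mem_erase.2 ⟨hne, hj⟩)
  · exact h.2 j' (Finset.mem_erase.2 ⟨Ne.symm hne, hj'⟩)

/-- The possible pairs of a set of `K` best ports and the next best port. -/
def orderIndices (M K : ℕ) : Finset (Σ _ : Finset (Fin M), Fin M) :=
  (Finset.powersetCard K Finset.univ).sigma fun S => Sᶜ

lemma mem_orderIndices {M K : ℕ} {p : Σ _ : Finset (Fin M), Fin M} :
    p ∈ orderIndices M K ↔ p.1.card = K ∧ p.2 ∈ p.1ᶜ := by
  simp [orderIndices, Finset.mem_powersetCard]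

lemma card_orderIndices (M K : ℕ) : (orderIndices M K).card = M.choose K * (M - K) := by
  rw [orderIndices, Finset.card_sigma, Finset.sum_congr rfl fun S hS => by
    rw [Finset.card_compl, (Finset.mem_powersetCard.1 hS).2, Fintype.card_fin]]
  simp

lemma exists_mem_orderEvent_iff {M K : ℕ} (hKM : K < M) {z : ℝ} {y : Fin M → ℝ}
    (hy : Function.Injective y) {S : Finset (Fin M)} (hS : IsTopK K y S) :
    (∃ p ∈ orderIndices M K, y ∈ orderEvent z p.1 p.2) ↔ ∑ i ∈ S, y i ≤ z := by
  constructor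
  · rintro ⟨p, hp, hyp⟩
    obtain ⟨hcard, -⟩ := mem_orderIndices.1 hp
    have : S = p.1 := hS.unique hy (hcard ▸ isTopK_of_mem_orderEvent hyp)
    rw [this]
    exact hyp.1.2
  · intro hz
    have hne : (Sᶜ).Nonempty := by
      rw [← Finset.card_pos, Finset.card_compl, hS.1, Fintype.card_fin]
      omega
    -- The next best port is a maximiser outside `S`, which exists because `K < M`.
    obtain ⟨j, hj, hmax⟩ := Finset.exists_max_image Sᶜ y hne
    have hjS := Finset.mem_compl.1 hj
    refine ⟨⟨S, j⟩, mem_orderIndices.2 ⟨hS.1, hj⟩, ⟨fun i hi => ?_, hz⟩, fun i hi =>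
      hmax i (Finset.mem_of_mem_erase hi)⟩
    exact lt_of_le_of_ne (hS.2 i hi j hjS) fun h : y j = y i => hjS (hy h ▸ hi)

lemma pi_iUnion_orderEvent {M : ℕ} (ν : Measure ℝ) [IsProbabilityMeasure ν]
    [NullSingletonClass ν] (K : ℕ) (z : ℝ) :
    (Measure.pi fun _ : Fin M => ν) (⋃ p ∈ orderIndices M K, orderEvent z p.1 p.2) =
      ∑ p ∈ orderIndices M K, (Measure.pi fun _ : Fin M => ν) (orderEvent z p.1 p.2) := by
  -- The events are disjoint only off the null set of ties.
  refine measure_biUnion_finset₀ (fun p hp q hq hpq => ?_)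
    fun p _ => (measurableSet_orderEvent z p.1 p.2).nullMeasurableSet
  refine measure_mono_null (fun y hy => ?_) (ae_iff.1 (ae_injective_pi (M := M) ν))
  intro hinj
  obtain ⟨hp1, hp2⟩ := mem_orderIndices.1 hp
  obtain ⟨hq1, hq2⟩ := mem_orderIndices.1 hq
  obtain ⟨h1, h2⟩ := orderEvent_index_unique hinj hp1 hq1 hp2 hq2 hy.1 hy.2
  exact hpq (Sigma.ext h1 (heq_of_eq h2))

/-- The conditional probability of outage given the reference SNR. -/
lemma pi_portLaw_iUnion_orderEvent {ω μ x₀ : ℝ} (hω : 0 < ω) (hμ₀ : 0 ≤ μ) (hμ₁ : μ < 1)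
    (hx₀ : 0 ≤ x₀) {M K T : ℕ} (hK : 1 ≤ K) (hKM : K < M) (hT : T = M - K - 1) (z : ℝ) :
    (Measure.pi fun _ : Fin M => portLaw ω μ x₀)
        (⋃ p ∈ orderIndices M K, orderEvent z p.1 p.2) =
      ∫⁻ v in Set.Ioc 0 (z / K), ENNReal.ofReal ((M.choose K : ℝ) * (T + 1) *
        Phi ω μ K z v x₀ * Psi ω μ T v x₀ * condDensity ω μ x₀ v) := by
  have := isProbabilityMeasure_portLaw hω hμ₀ hμ₁ hx₀
  have hPsi : ∀ v, 0 ≤ v → 0 ≤ Psi ω μ T v x₀ := fun v hv => by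
    rw [Psi, ← toReal_portLaw_Iic hω hμ₀ hμ₁ hx₀ hv]
    exact pow_nonneg measureReal_nonneg _
  have hPhi : ∀ v, 0 ≤ v → 0 ≤ Phi ω μ K z v x₀ := fun v hv => Phi_nonneg hω hμ₀ hx₀ hv hK z
  have hcond := condDensity_nonneg hω.le μ x₀
  have hterm : ∀ p ∈ orderIndices M K,
      (Measure.pi fun _ : Fin M => portLaw ω μ x₀) (orderEvent z p.1 p.2) =
        ∫⁻ v in Set.Ioi 0,
          ENNReal.ofReal (Phi ω μ K z v x₀ * Psi ω μ T v x₀ * condDensity ω μ x₀ v) := by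
    intro p hp
    obtain ⟨hcard, hj⟩ := mem_orderIndices.1 hp
    have hcard' : (p.1ᶜ.erase p.2).card = T := by
      rw [Finset.card_erase_of_mem hj, Finset.card_compl, hcard, Fintype.card_fin, hT]
    rw [pi_orderEvent _ _ hj, lintegral_portLaw]
    refine setLIntegral_congr_fun measurableSet_Ioi fun v hv => ?_
    have hv' : 0 ≤ v := (Set.mem_Ioi.1 hv).le
    rw [pi_portLaw_lt_and_sum_le hω hμ₀ hμ₁ hx₀ hv' hK z hcard, ← ofReal_measureReal,
      pi_portLaw_forall_le hω hμ₀ hμ₁ hx₀ hv', hcard', ← ENNReal.ofReal_mul (hPhi v hv'),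
      ← ENNReal.ofReal_mul (hcond v)]
    congr 1
    ring
  rw [pi_iUnion_orderEvent, Finset.sum_congr rfl hterm, Finset.sum_const, card_orderIndices,
    nsmul_eq_mul, ← lintegral_const_mul' _ _ (ENNReal.natCast_ne_top _), ← lintegral_indicator measurableSet_Ioi,
    ← lintegral_indicator measurableSet_Ioc]
  congr 1 with v
  by_cases hv : 0 < v
  · have hMK : ((M - K : ℕ) : ℝ) = T + 1 := by
      rw [show M - K = T + 1 by omega]
      push_cast
      rfl
    by_cases hvz : v ≤ z / K
    · rw [Set.indicator_of_mem (Set.mem_Ioi.2 hv), Set.indicator_of_mem (Set.mem_Ioc.2 ⟨hv, hvz⟩),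
        ← ENNReal.ofReal_natCast, ← ENNReal.ofReal_mul (by positivity)]
      congr 1
      push_cast
      rw [hMK]
      ring
    · have hK' : (0 : ℝ) < K := by exact_mod_cast hK
      -- Beyond `z / K` the threshold forces a sum above `z`, which truncates the integral.
      have hPhi0 : Phi ω μ K z v x₀ = 0 := if_neg fun h => hvz (by
        rw [le_div_iff₀ hK']; linarith)
      simp [hv, hvz, hPhi0]
  · simp [hv]

/-! ### The conditional law of the port SNRs -/

lemma measurable_snr_portChannel_pi (PS σ μ : ℝ) (M : ℕ) :
    Measurable fun p : ℂ × (Fin M → ℂ) => fun m => snr PS σ (portChannel μ p.1 (p.2 m)) := by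
  rw [measurable_pi_iff]
  exact fun m => (measurable_snr PS σ).comp ((measurable_portChannel μ).comp
    (measurable_fst.prodMk ((measurable_pi_apply m).comp measurable_snd)))

lemma measurable_snr_portChannel_pi_right (PS σ μ : ℝ) (M : ℕ) (a : ℂ) :
    Measurable fun (e : Fin M → ℂ) m => snr PS σ (portChannel μ a (e m)) := by
  rw [measurable_pi_iff]
  exact fun m => (measurable_snr PS σ).comp
    ((measurable_portChannel_right μ a).comp (measurable_pi_apply m))

lemma measurable_snr_prodMk_snr_portChannel (PS σ μ : ℝ) (M : ℕ) :
    Measurable fun p : ℂ × (Fin M → ℂ) =>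
      (snr PS σ p.1, fun m => snr PS σ (portChannel μ p.1 (p.2 m))) :=
  Measurable.prodMk (by fun_prop) (measurable_snr_portChannel_pi PS σ μ M)

/-- The conditional law of the port SNRs given the reference SNR. -/
def portKernel (PS σ α μ : ℝ) (M : ℕ) : Kernel ℝ (Fin M → ℝ) where
  -- Any reference coefficient of SNR `x₀` would do; the nonnegative real one depends measurably on
  -- `x₀`.
  toFun x₀ := (Measure.pi fun _ : Fin M => complexGaussian α).map fun e m =>
    snr PS σ (portChannel μ ((√(x₀ * σ ^ 2 / PS) : ℝ) : ℂ) (e m))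
  measurable' := by
    have hm : Measurable fun p : ℝ × (Fin M → ℂ) => fun m =>
        snr PS σ (portChannel μ ((√(p.1 * σ ^ 2 / PS) : ℝ) : ℂ) (p.2 m)) :=
      (measurable_snr_portChannel_pi PS σ μ M).comp (f := fun p : ℝ × (Fin M → ℂ) =>
        (((√(p.1 * σ ^ 2 / PS) : ℝ) : ℂ), p.2)) (by fun_prop)
    refine Measure.measurable_of_measurable_coe _ fun A hA => ?_
    have h := measurable_measure_prodMk_left
      (ν := Measure.pi fun _ : Fin M => complexGaussian α) (hm hA)
    convert h using 1
    ext x₀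
    exact Measure.map_apply (hm.comp measurable_prodMk_left) hA

lemma map_pi_snr_portChannel {PS σ α μ : ℝ} (hPS : 0 < PS) (hσ : 0 < σ) (hα : 0 < α) (hμ₀ : 0 ≤ μ)
    (hμ₁ : μ < 1) (M : ℕ) (a : ℂ) :
    (Measure.pi fun _ : Fin M => complexGaussian α).map
        (fun e m => snr PS σ (portChannel μ a (e m))) =
      Measure.pi fun _ => portLaw (PS * α / σ ^ 2 * (1 - μ))⁻¹ μ (snr PS σ a) := by
  have hm : Measurable fun e => snr PS σ (portChannel μ a e) := by fun_prop
  have : IsProbabilityMeasure ((complexGaussian α).map fun e => snr PS σ (portChannel μ a e)) :=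
    Measure.isProbabilityMeasure_map hm.aemeasurable
  rw [Measure.pi_map_pi (f := fun _ e => snr PS σ (portChannel μ a e))
    fun _ => hm.aemeasurable, map_snr_portChannel hPS hσ hα hμ₀ hμ₁]

lemma snr_sqrt {PS σ x₀ : ℝ} (hPS : 0 < PS) (hσ : 0 < σ) (hx₀ : 0 ≤ x₀) :
    snr PS σ ((√(x₀ * σ ^ 2 / PS) : ℝ) : ℂ) = x₀ := by
  rw [snr, Complex.norm_real, Real.norm_eq_abs, sq_abs, Real.sq_sqrt (by positivity)]
  field_simp

lemma portKernel_apply {PS σ α μ : ℝ} (hPS : 0 < PS) (hσ : 0 < σ) (hα : 0 < α) (hμ₀ : 0 ≤ μ)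
    (hμ₁ : μ < 1) (M : ℕ) {x₀ : ℝ} (hx₀ : 0 ≤ x₀) :
    portKernel PS σ α μ M x₀ =
      Measure.pi fun _ => portLaw (PS * α / σ ^ 2 * (1 - μ))⁻¹ μ x₀ := by
  have h := map_pi_snr_portChannel hPS hσ hα hμ₀ hμ₁ M ((√(x₀ * σ ^ 2 / PS) : ℝ) : ℂ)
  rw [snr_sqrt hPS hσ hx₀] at h
  exact h

instance (PS σ α μ : ℝ) (M : ℕ) : IsMarkovKernel (portKernel PS σ α μ M) :=
  ⟨fun _ => Measure.isProbabilityMeasure_map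
    (measurable_snr_portChannel_pi_right PS σ μ M _).aemeasurable⟩

/-- The law of the ports given `h₀ = a` depends on `a` only through its SNR, so conditioning on `h₀`
may be replaced by conditioning on `γ₀`. -/
lemma map_prod_snr_eq_compProd {PS σ α μ : ℝ} (hPS : 0 < PS) (hσ : 0 < σ) (hα : 0 < α)
    (hμ₀ : 0 ≤ μ) (hμ₁ : μ < 1) (M : ℕ) :
    ((complexGaussian α).prod (Measure.pi fun _ : Fin M => complexGaussian α)).map
        (fun p => (snr PS σ p.1, fun m => snr PS σ (portChannel μ p.1 (p.2 m)))) =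
      (complexGaussian α).map (snr PS σ) ⊗ₘ portKernel PS σ α μ M := by
  have hm := measurable_snr_prodMk_snr_portChannel PS σ μ M
  have : IsProbabilityMeasure ((complexGaussian α).map (snr PS σ)) :=
    Measure.isProbabilityMeasure_map (by fun_prop)
  ext A hA
  rw [Measure.map_apply hm hA, Measure.prod_apply (hm hA), Measure.compProd_apply hA,
    lintegral_map (Kernel.measurable_kernel_prodMk_left hA) (by fun_prop)]
  congr 1 with a
  have hma := measurable_snr_portChannel_pi_right PS σ μ M a
  rw [portKernel_apply hPS hσ hα hμ₀ hμ₁ M (snr_nonneg hPS.le σ a),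
    ← map_pi_snr_portChannel hPS hσ hα hμ₀ hμ₁, Measure.map_apply hma (measurable_prodMk_left hA)]
  rfl

section

variable {Ω : Type*} [MeasurableSpace Ω] {P : Measure Ω} [IsProbabilityMeasure P]

lemma map_prod_eq_of_iIndepFun {M : ℕ} {ν : Measure ℂ} [IsProbabilityMeasure ν] {h₀ : Ω → ℂ}
    {e : Fin M → Ω → ℂ} (hh₀ : HasLaw h₀ ν P) (he : ∀ m, HasLaw (e m) ν P)
    (hindep : iIndepFun (fun i : Option (Fin M) => i.elim h₀ e) P) :
    P.map (fun s => (h₀ s, fun m => e m s)) = ν.prod (Measure.pi fun _ => ν) := by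
  have hlaw : ∀ i : Option (Fin M), HasLaw (i.elim h₀ e) ν P := fun i => by
    cases i
    · exact hh₀
    · exact he _
  have h := (iIndepFun_iff_map_fun_eq_pi_map fun i => (hlaw i).aemeasurable).1 hindep
  simp_rw [(hlaw _).map_eq] at h
  rw [← Measure.pi_map_piOptionEquivProd (fun _ : Option (Fin M) => ν)] at h
  have hm : Measurable fun w : Option (Fin M) → ℂ => (w none, fun m : Fin M => w (some m)) := by
    fun_prop
  have h2 := congrArg (Measure.map fun w : Option (Fin M) → ℂ =>
    (w none, fun m : Fin M => w (some m))) h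
  rw [Measure.map_map hm (MeasurableEquiv.measurable _),
    AEMeasurable.map_map_of_aemeasurable hm.aemeasurable
      (aemeasurable_pi_lambda _ fun i => (hlaw i).aemeasurable)] at h2
  refine h2.trans ?_
  -- `piOptionEquivProd` lists the `some` coordinates first.
  exact Measure.prod_swap

end

/-! ### The outage probability -/

lemma outageIntegrand_nonneg {φ ω μ x₀ v : ℝ} (hφ : 0 < φ) (hω : 0 < ω) (hμ₀ : 0 ≤ μ)
    (hμ₁ : μ < 1) (hx₀ : 0 ≤ x₀) (hv : 0 ≤ v) {M K : ℕ} (hK : 1 ≤ K) (T : ℕ) (z : ℝ) :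
    0 ≤ outageIntegrand φ ω μ M K T z x₀ v := by
  have h1 := Phi_nonneg hω hμ₀ hx₀ hv hK z
  have h2 := condDensity_nonneg hω.le μ x₀ v
  have h3 : 0 ≤ Psi ω μ T v x₀ := by
    rw [Psi, ← toReal_portLaw_Iic hω hμ₀ hμ₁ hx₀ hv]
    positivity
  unfold outageIntegrand refDensity
  positivity

/-- Joint measurability is not read off the formulas: on the relevant domain `Phi` and `Psi` are
kernel probabilities of measurable events for fixed sets of `K` and `T` ports. -/
lemma aemeasurable_outageIntegrand {PS σ α μ φ ω : ℝ} (hPS : 0 < PS) (hσ : 0 < σ) (hα : 0 < α)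
    (hμ₀ : 0 ≤ μ) (hμ₁ : μ < 1) (hφ : φ = PS * α / σ ^ 2) (hω : ω = (φ * (1 - μ))⁻¹)
    {M K T : ℕ} (hK : 1 ≤ K) (hKM : K < M) (hT : T = M - K - 1) (z : ℝ) :
    AEMeasurable (fun p : ℝ × ℝ => outageIntegrand φ ω μ M K T z p.1 p.2)
      ((volume.restrict (Set.Ioi 0)).prod (volume.restrict (Set.Ioc 0 (z / K)))) := by
  have h1 : 0 < 1 - μ := by linarith
  have hω' : 0 < ω := by rw [hω, hφ]; positivity
  obtain ⟨S, -, hS⟩ := Finset.exists_subset_card_eq (s := (Finset.univ : Finset (Fin M))) (n := K)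
    (by simpa using hKM.le)
  obtain ⟨S', -, hS'⟩ := Finset.exists_subset_card_eq (s := (Finset.univ : Finset (Fin M)))
    (n := T) (by rw [Finset.card_univ, Fintype.card_fin]; omega)
  set κ : Kernel (ℝ × ℝ) (Fin M → ℝ) := (portKernel PS σ α μ M).comap Prod.fst measurable_fst
  have hA : MeasurableSet {q : (ℝ × ℝ) × (Fin M → ℝ) |
      (∀ m ∈ S, q.1.2 < q.2 m) ∧ ∑ m ∈ S, q.2 m ≤ z} := by measurability
  have hB : MeasurableSet {q : (ℝ × ℝ) × (Fin M → ℝ) | ∀ m ∈ S', q.2 m ≤ q.1.2} := by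
    measurability
  have hmA := (Kernel.measurable_kernel_prodMk_left (κ := κ) hA).ennreal_toReal
  have hmB := (Kernel.measurable_kernel_prodMk_left (κ := κ) hB).ennreal_toReal
  have hmc := measurable_condDensity ω μ
  have hmr : Measurable fun p : ℝ × ℝ => refDensity φ p.1 := by
    unfold refDensity
    fun_prop
  refine ⟨_, ((((hmA.const_mul ((M.choose K : ℝ) * (T + 1))).mul hmB).mul hmc).mul hmr), ?_⟩
  rw [Measure.prod_restrict]
  refine (ae_restrict_mem (measurableSet_Ioi.prod measurableSet_Ioc)).mono fun p hp => ?_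
  have hx₀ : 0 ≤ p.1 := (Set.mem_Ioi.1 hp.1).le
  have hv : 0 ≤ p.2 := hp.2.1.le
  have hκ : κ p = Measure.pi fun _ => portLaw ω μ p.1 := by
    rw [Kernel.comap_apply, portKernel_apply hPS hσ hα hμ₀ hμ₁ M hx₀, hω, hφ]
  have eA : (κ p (Prod.mk p ⁻¹' {q : (ℝ × ℝ) × (Fin M → ℝ) |
      (∀ m ∈ S, q.1.2 < q.2 m) ∧ ∑ m ∈ S, q.2 m ≤ z})).toReal = Phi ω μ K z p.2 p.1 := by
    rw [hκ, ← ENNReal.toReal_ofReal (Phi_nonneg hω' hμ₀ hx₀ hv hK z),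
      ← pi_portLaw_lt_and_sum_le hω' hμ₀ hμ₁ hx₀ hv hK z hS]
    rfl
  have eB : (κ p (Prod.mk p ⁻¹' {q : (ℝ × ℝ) × (Fin M → ℝ) |
      ∀ m ∈ S', q.2 m ≤ q.1.2})).toReal = Psi ω μ T p.2 p.1 := by
    rw [hκ, ← hS', ← pi_portLaw_forall_le hω' hμ₀ hμ₁ hx₀ hv S']
    rfl
  simp only [outageIntegrand, Pi.mul_apply, eA, eB]

lemma compProd_iUnion_orderEvent {PS σ α μ φ ω : ℝ} (hPS : 0 < PS) (hσ : 0 < σ) (hα : 0 < α)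
    (hμ₀ : 0 ≤ μ) (hμ₁ : μ < 1) (hφ : φ = PS * α / σ ^ 2) (hω : ω = (φ * (1 - μ))⁻¹)
    {M K T : ℕ} (hK : 1 ≤ K) (hKM : K < M) (hT : T = M - K - 1) (z : ℝ) :
    ((complexGaussian α).map (snr PS σ) ⊗ₘ portKernel PS σ α μ M)
        (Prod.snd ⁻¹' ⋃ p ∈ orderIndices M K, orderEvent z p.1 p.2) =
      ∫⁻ p : ℝ × ℝ, ENNReal.ofReal (outageIntegrand φ ω μ M K T z p.1 p.2)
        ∂(volume.restrict (Set.Ioi 0)).prod (volume.restrict (Set.Ioc 0 (z / K))) := by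
  have h1 : 0 < 1 - μ := by linarith
  have hφ' : 0 < φ := by rw [hφ]; positivity
  have hω' : 0 < ω := by rw [hω]; positivity
  have hU : MeasurableSet (⋃ p ∈ orderIndices M K, orderEvent z p.1 p.2) :=
    Finset.measurableSet_biUnion _ fun p _ => measurableSet_orderEvent z p.1 p.2
  have hmr : Measurable fun x => refDensity φ x := by
    unfold refDensity
    fun_prop
  have : IsProbabilityMeasure ((complexGaussian α).map (snr PS σ)) :=
    Measure.isProbabilityMeasure_map (by fun_prop)
  rw [Measure.compProd_apply (measurable_snd hU), map_snr_complexGaussian hPS hσ hα, ← hφ,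
    lintegral_withDensity_eq_lintegral_mul_non_measurable _ hmr.ennreal_ofReal
      (.of_forall fun _ => ENNReal.ofReal_lt_top), lintegral_prod _
      (aemeasurable_outageIntegrand hPS hσ hα hμ₀ hμ₁ hφ hω hK hKM hT z).ennreal_ofReal]
  refine setLIntegral_congr_fun measurableSet_Ioi fun x₀ hx => ?_
  have hx₀ : 0 ≤ x₀ := (Set.mem_Ioi.1 hx).le
  have hr : 0 ≤ refDensity φ x₀ := by
    unfold refDensity
    positivity
  simp only [Pi.mul_apply]
  have hpre : Prod.mk x₀ ⁻¹' (Prod.snd ⁻¹' ⋃ p ∈ orderIndices M K, orderEvent z p.1 p.2) =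
    ⋃ p ∈ orderIndices M K, orderEvent z p.1 p.2 := rfl
  rw [hpre, portKernel_apply hPS hσ hα hμ₀ hμ₁ M hx₀, ← hφ, ← hω,
    pi_portLaw_iUnion_orderEvent hω' hμ₀ hμ₁ hx₀ hK hKM hT,
    ← lintegral_const_mul' _ _ ENNReal.ofReal_ne_top]
  congr 1 with v
  rw [← ENNReal.ofReal_mul hr, outageIntegrand, mul_comm]

/-- The integrand is nonnegative and its integral is a probability. -/
lemma integrable_outageIntegrand {PS σ α μ φ ω : ℝ} (hPS : 0 < PS) (hσ : 0 < σ) (hα : 0 < α)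
    (hμ₀ : 0 ≤ μ) (hμ₁ : μ < 1) (hφ : φ = PS * α / σ ^ 2) (hω : ω = (φ * (1 - μ))⁻¹)
    {M K T : ℕ} (hK : 1 ≤ K) (hKM : K < M) (hT : T = M - K - 1) (z : ℝ) :
    (0 ≤ᵐ[(volume.restrict (Set.Ioi 0)).prod (volume.restrict (Set.Ioc 0 (z / K)))]
      fun p : ℝ × ℝ => outageIntegrand φ ω μ M K T z p.1 p.2) ∧
    Integrable (fun p : ℝ × ℝ => outageIntegrand φ ω μ M K T z p.1 p.2)
      ((volume.restrict (Set.Ioi 0)).prod (volume.restrict (Set.Ioc 0 (z / K)))) := by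
  have h1 : 0 < 1 - μ := by linarith
  have hφ' : 0 < φ := by rw [hφ]; positivity
  have hω' : 0 < ω := by rw [hω]; positivity
  have hnn : 0 ≤ᵐ[(volume.restrict (Set.Ioi 0)).prod (volume.restrict (Set.Ioc 0 (z / K)))]
      fun p : ℝ × ℝ => outageIntegrand φ ω μ M K T z p.1 p.2 := by
    rw [Measure.prod_restrict]
    exact (ae_restrict_mem (measurableSet_Ioi.prod measurableSet_Ioc)).mono fun p hp =>
      outageIntegrand_nonneg hφ' hω' hμ₀ hμ₁ (Set.mem_Ioi.1 hp.1).le hp.2.1.le hK T z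
  refine ⟨hnn, (aemeasurable_outageIntegrand hPS hσ hα hμ₀ hμ₁ hφ hω hK hKM hT
    z).aestronglyMeasurable, ?_⟩
  rw [hasFiniteIntegral_iff_ofReal hnn,
    ← compProd_iUnion_orderEvent hPS hσ hα hμ₀ hμ₁ hφ hω hK hKM hT z]
  have : IsProbabilityMeasure ((complexGaussian α).map (snr PS σ)) :=
    Measure.isProbabilityMeasure_map (by fun_prop)
  exact measure_lt_top _ _

/-! ### Transfer to the probability space of the channels -/

section

variable {Ω : Type*} [MeasurableSpace Ω] {P : Measure Ω}
  {PS σ α μ φ ω : ℝ} {M : ℕ} {h₀ : Ω → ℂ} {e : Fin M → Ω → ℂ} {γ₀ : Ω → ℝ} {γ : Ω → Fin M → ℝ}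

lemma aemeasurable_refSNR (hh₀ : HasLaw h₀ (complexGaussian α) P)
    (hγ₀ : ∀ s, γ₀ s = snr PS σ (h₀ s)) : AEMeasurable γ₀ P := by
  rw [funext hγ₀]
  exact (measurable_snr PS σ).comp_aemeasurable hh₀.aemeasurable

lemma aemeasurable_portSNR (hh₀ : HasLaw h₀ (complexGaussian α) P)
    (he : ∀ m, HasLaw (e m) (complexGaussian α) P)
    (hγ : ∀ s m, γ s m = snr PS σ (portChannel μ (h₀ s) (e m s))) : AEMeasurable γ P := by
  refine aemeasurable_pi_lambda _ fun m => ?_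
  rw [show (fun s => γ s m) = fun s => snr PS σ (portChannel μ (h₀ s) (e m s)) from
    funext fun s => hγ s m]
  exact (measurable_snr PS σ).comp_aemeasurable
    ((measurable_portChannel μ).comp_aemeasurable (hh₀.aemeasurable.prodMk (he m).aemeasurable))

lemma map_refSNR (hh₀ : HasLaw h₀ (complexGaussian α) P)
    (hγ₀ : ∀ s, γ₀ s = snr PS σ (h₀ s)) :
    P.map γ₀ = (complexGaussian α).map (snr PS σ) := by
  rw [funext hγ₀, ← hh₀.map_eq, AEMeasurable.map_map_of_aemeasurable (by fun_prop)
    hh₀.aemeasurable]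
  rfl

variable [IsProbabilityMeasure P]

lemma map_refSNR_portSNR (hPS : 0 < PS) (hσ : 0 < σ) (hα : 0 < α) (hμ₀ : 0 ≤ μ) (hμ₁ : μ < 1)
    (hh₀ : HasLaw h₀ (complexGaussian α) P) (he : ∀ m, HasLaw (e m) (complexGaussian α) P)
    (hindep : iIndepFun (fun i : Option (Fin M) => i.elim h₀ e) P)
    (hγ₀ : ∀ s, γ₀ s = snr PS σ (h₀ s))
    (hγ : ∀ s m, γ s m = snr PS σ (portChannel μ (h₀ s) (e m s))) :
    P.map (fun s => (γ₀ s, γ s)) = P.map γ₀ ⊗ₘ portKernel PS σ α μ M := by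
  rw [map_refSNR hh₀ hγ₀, ← map_prod_snr_eq_compProd hPS hσ hα hμ₀ hμ₁,
    ← map_prod_eq_of_iIndepFun hh₀ he hindep,
    AEMeasurable.map_map_of_aemeasurable
      (measurable_snr_prodMk_snr_portChannel PS σ μ M).aemeasurable
      (hh₀.aemeasurable.prodMk (aemeasurable_pi_lambda _ fun m => (he m).aemeasurable))]
  congr 1
  ext s : 1
  exact Prod.ext (hγ₀ s) (funext (hγ s))

/-- Given the reference SNR, the port SNRs are independent with law `portLaw`. -/
lemma condDistrib_portSNR (hPS : 0 < PS) (hσ : 0 < σ) (hα : 0 < α) (hμ₀ : 0 ≤ μ) (hμ₁ : μ < 1)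
    (hφ : φ = PS * α / σ ^ 2) (hω : ω = (φ * (1 - μ))⁻¹)
    (hh₀ : HasLaw h₀ (complexGaussian α) P) (he : ∀ m, HasLaw (e m) (complexGaussian α) P)
    (hindep : iIndepFun (fun i : Option (Fin M) => i.elim h₀ e) P)
    (hγ₀ : ∀ s, γ₀ s = snr PS σ (h₀ s))
    (hγ : ∀ s m, γ s m = snr PS σ (portChannel μ (h₀ s) (e m s))) :
    ∀ᵐ x₀ ∂(P.map γ₀), 0 ≤ x₀ ∧
      condDistrib γ γ₀ P x₀ = Measure.pi fun _ => portLaw ω μ x₀ := by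
  have hnn : ∀ᵐ x₀ ∂(P.map γ₀), 0 ≤ x₀ :=
    (ae_map_iff (aemeasurable_refSNR hh₀ hγ₀) measurableSet_Ici).2
      (.of_forall fun s => (hγ₀ s).symm ▸ snr_nonneg hPS.le σ (h₀ s))
  filter_upwards [condDistrib_ae_eq_of_measure_eq_compProd _ (aemeasurable_portSNR hh₀ he hγ)
    (map_refSNR_portSNR hPS hσ hα hμ₀ hμ₁ hh₀ he hindep hγ₀ hγ), hnn] with x₀ h1 h2
  exact ⟨h2, by rw [h1, portKernel_apply hPS hσ hα hμ₀ hμ₁ M h2, hω, hφ]⟩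

lemma ae_injective_portSNR (hPS : 0 < PS) (hσ : 0 < σ) (hα : 0 < α) (hμ₀ : 0 ≤ μ) (hμ₁ : μ < 1)
    (hh₀ : HasLaw h₀ (complexGaussian α) P) (he : ∀ m, HasLaw (e m) (complexGaussian α) P)
    (hindep : iIndepFun (fun i : Option (Fin M) => i.elim h₀ e) P)
    (hγ : ∀ s m, γ s m = snr PS σ (portChannel μ (h₀ s) (e m s))) :
    ∀ᵐ s ∂P, Function.Injective (γ s) := by
  have hω : 0 < (PS * α / σ ^ 2 * (1 - μ))⁻¹ := by
    have : 0 < 1 - μ := by linarith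
    positivity
  have hms : MeasurableSet {q : ℝ × (Fin M → ℝ) | Function.Injective q.2} := by
    have : {q : ℝ × (Fin M → ℝ) | Function.Injective q.2} =
        ⋂ (i : Fin M) (j : Fin M) (_ : i ≠ j), {q | q.2 i = q.2 j}ᶜ := by
      ext q
      simp only [Set.mem_ofPred_eq, Set.mem_iInter, Set.mem_compl_iff, Function.Injective]
      exact forall₂_congr fun i j => not_imp_not.symm
    rw [this]
    exact .iInter fun i => .iInter fun j => .iInter fun _ =>
      (measurableSet_eq_fun (by fun_prop) (by fun_prop)).compl
  have hcomp := map_refSNR_portSNR hPS hσ hα hμ₀ hμ₁ hh₀ he hindep (fun _ => rfl) hγ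
  have h0 := aemeasurable_refSNR (PS := PS) (σ := σ) hh₀ fun _ => rfl
  have h1 : ∀ᵐ q ∂(P.map (fun s => snr PS σ (h₀ s)) ⊗ₘ portKernel PS σ α μ M),
      Function.Injective q.2 := by
    have hnn : ∀ᵐ x₀ ∂(P.map fun s => snr PS σ (h₀ s)), 0 ≤ x₀ :=
      (ae_map_iff h0 measurableSet_Ici).2 (.of_forall fun s => snr_nonneg hPS.le σ (h₀ s))
    refine Measure.ae_compProd_of_ae_ae hms (hnn.mono fun x₀ hx => ?_)
    have := isProbabilityMeasure_portLaw hω hμ₀ hμ₁ hx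
    rw [portKernel_apply hPS hσ hα hμ₀ hμ₁ M hx]
    exact ae_injective_pi _
  rw [← hcomp] at h1
  exact ae_of_ae_map (h0.prodMk (aemeasurable_portSNR hh₀ he hγ)) h1

lemma real_outage_eq_integral (hPS : 0 < PS) (hσ : 0 < σ) (hα : 0 < α) (hμ₀ : 0 ≤ μ) (hμ₁ : μ < 1)
    (hφ : φ = PS * α / σ ^ 2) (hω : ω = (φ * (1 - μ))⁻¹)
    (hh₀ : HasLaw h₀ (complexGaussian α) P) (he : ∀ m, HasLaw (e m) (complexGaussian α) P)
    (hindep : iIndepFun (fun i : Option (Fin M) => i.elim h₀ e) P)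
    (hγ : ∀ s m, γ s m = snr PS σ (portChannel μ (h₀ s) (e m s)))
    {K T : ℕ} (hK : 1 ≤ K) (hKM : K < M) (hT : T = M - K - 1) (z : ℝ)
    {sel : Ω → Finset (Fin M)} (hsel : ∀ s, IsTopK K (γ s) (sel s)) :
    P.real {s | ∑ m ∈ sel s, γ s m ≤ z} =
      ∫ p : ℝ × ℝ, outageIntegrand φ ω μ M K T z p.1 p.2
        ∂(volume.restrict (Set.Ioi 0)).prod (volume.restrict (Set.Ioc 0 (z / K))) := by
  obtain ⟨hnn, hint⟩ := integrable_outageIntegrand hPS hσ hα hμ₀ hμ₁ hφ hω hK hKM hT z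
  have hU : MeasurableSet (⋃ p ∈ orderIndices M K, orderEvent z p.1 p.2) :=
    Finset.measurableSet_biUnion _ fun p _ => measurableSet_orderEvent z p.1 p.2
  have h0 := aemeasurable_refSNR (PS := PS) (σ := σ) hh₀ fun _ => rfl
  -- Measurability of `sel` is never needed: without ties the selected set is determined, so the
  -- event agrees almost surely with one defined by `γ` alone.
  have hev : {s | ∑ m ∈ sel s, γ s m ≤ z} =ᵐ[P] (fun s => (snr PS σ (h₀ s), γ s)) ⁻¹'
      (Prod.snd ⁻¹' ⋃ p ∈ orderIndices M K, orderEvent z p.1 p.2) := by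
    filter_upwards [ae_injective_portSNR hPS hσ hα hμ₀ hμ₁ hh₀ he hindep hγ] with s hs
    refine propext ?_
    change _ ≤ z ↔ γ s ∈ ⋃ p ∈ orderIndices M K, orderEvent z p.1 p.2
    simp only [Set.mem_iUnion, exists_prop]
    exact (exists_mem_orderEvent_iff hKM hs (hsel s)).symm
  rw [integral_eq_lintegral_of_nonneg_ae hnn hint.aestronglyMeasurable, Measure.real,
    measure_congr hev, ← Measure.map_apply_of_aemeasurable
      (h0.prodMk (aemeasurable_portSNR hh₀ he hγ)) (measurable_snd hU),
    map_refSNR_portSNR hPS hσ hα hμ₀ hμ₁ hh₀ he hindep (fun _ => rfl) hγ,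
    map_refSNR hh₀ fun _ => rfl, compProd_iUnion_orderEvent hPS hσ hα hμ₀ hμ₁ hφ hω hK hKM hT z]

end

end FAS

end

theorem mainTheorem2
    {Ω : Type*} [MeasurableSpace Ω] (P : Measure Ω) [IsProbabilityMeasure P]
    -- numbers of ports, of selected ports, and `T`
    (M K T : ℕ) (hK : 1 ≤ K) (hKM : K < M) (hT : T = M - K - 1)
    -- transmit power, noise power `σ²`, average channel gain, correlation factor, data rate
    (PS σ α μ R : ℝ) (hPS : 0 < PS) (hσ : 0 < σ) (hα : 0 < α)
    (hμ₀ : 0 ≤ μ) (hμ₁ : μ < 1) (hR : 0 ≤ R)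
    -- average SNR, rate parameter, outage threshold
    (φ ω z : ℝ) (hφ : φ = PS * α / σ ^ 2) (hω : ω = (φ * (1 - μ))⁻¹) (hz : z = 2 ^ R - 1)
    -- independent complex Gaussian `h₀, e₁, …, e_M`
    (h₀ : Ω → ℂ) (e : Fin M → Ω → ℂ)
    (hh₀ : HasLaw h₀ (FAS.complexGaussian α) P)
    (he : ∀ m, HasLaw (e m) (FAS.complexGaussian α) P)
    (hindep : iIndepFun (fun i : Option (Fin M) => i.elim h₀ e) P)
    -- SNRs of the reference port and of the ports
    (γ₀ : Ω → ℝ) (hγ₀ : ∀ s, γ₀ s = FAS.snr PS σ (h₀ s))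
    (γ : Ω → Fin M → ℝ)
    (hγ : ∀ s m, γ s m = FAS.snr PS σ (FAS.portChannel μ (h₀ s) (e m s)))
    -- selected ports
    (sel : Ω → Finset (Fin M)) (hsel : ∀ s, FAS.IsTopK K (γ s) (sel s)) :
    -- `Ψ` is the conditional probability that `T` given ports have SNR at most `v`
    (∀ᵐ x₀ ∂(P.map γ₀), ∀ S : Finset (Fin M), S.card = T → ∀ v : ℝ, 0 ≤ v →
      (condDistrib γ γ₀ P x₀).real {y | ∀ m ∈ S, y m ≤ v} = FAS.Psi ω μ T v x₀) ∧
    -- the multi-series converge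
    (∀ x₀ v x : ℝ, 0 ≤ x₀ → 0 ≤ v → K * v ≤ x →
      Summable (fun r : Fin K → ℕ => FAS.sumDensityTerm ω μ v x₀ x r) ∧
      Summable (fun r : Fin K → ℕ => FAS.phiTerm ω μ x v x₀ r)) ∧
    -- `Φ` is the conditional probability that `K` given ports have SNR above `v` and SNR sum
    -- at most `x`, obtained by integrating the density of that sum
    (∀ᵐ x₀ ∂(P.map γ₀), ∀ S : Finset (Fin M), S.card = K → ∀ v x : ℝ, 0 ≤ v →
      (condDistrib γ γ₀ P x₀).real {y | (∀ m ∈ S, v < y m) ∧ ∑ m ∈ S, y m ≤ x} =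
        FAS.Phi ω μ K x v x₀) ∧
    (∀ x₀ v x : ℝ, 0 ≤ x₀ → 0 ≤ v → K * v ≤ x →
      IntervalIntegrable (FAS.sumDensity ω μ K v x₀) volume (K * v) x ∧
      FAS.Phi ω μ K x v x₀ = ∫ t in (K * v)..x, FAS.sumDensity ω μ K v x₀ t) ∧
    -- the outage probability
    Integrable (fun p : ℝ × ℝ => FAS.outageIntegrand φ ω μ M K T z p.1 p.2)
      ((volume.restrict (Set.Ioi 0)).prod (volume.restrict (Set.Ioc 0 (z / K)))) ∧
    P.real {s | Real.logb 2 (1 + ∑ m ∈ sel s, γ s m) ≤ R} =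
      ∫ x₀ in Set.Ioi (0 : ℝ), ∫ v in (0 : ℝ)..(z / K),
        FAS.outageIntegrand φ ω μ M K T z x₀ v := by
  have hμ' : 0 < 1 - μ := by linarith
  have hφ' : 0 < φ := by rw [hφ]; positivity
  have hω' : 0 < ω := by rw [hω]; positivity
  have hcond := FAS.condDistrib_portSNR hPS hσ hα hμ₀ hμ₁ hφ hω hh₀ he hindep hγ₀ hγ
  have hint := (FAS.integrable_outageIntegrand hPS hσ hα hμ₀ hμ₁ hφ hω hK hKM hT z).2
  refine ⟨?_, ?_, ?_, ?_, hint, ?_⟩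
  · filter_upwards [hcond] with x₀ hx S hS v hv
    rw [hx.2, FAS.pi_portLaw_forall_le hω' hμ₀ hμ₁ hx.1 hv, hS]
  · exact fun x₀ v x hx₀ hv hx =>
      ⟨FAS.summable_sumDensityTerm hω' hμ₀ hμ₁ hx₀ hv hK hx,
        FAS.summable_phiTerm hω' hμ₀ hμ₁ hx₀ hv hK hx⟩
  · filter_upwards [hcond] with x₀ hx S hS v x hv
    rw [hx.2, Measure.real, FAS.pi_portLaw_lt_and_sum_le hω' hμ₀ hμ₁ hx.1 hv hK x hS,
      ENNReal.toReal_ofReal (FAS.Phi_nonneg hω' hμ₀ hx.1 hv hK x)]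
  · refine fun x₀ v x hx₀ hv hx => ⟨?_, FAS.Phi_eq_integral hω' hμ₀ hμ₁ hx₀ hv hK hx⟩
    rw [intervalIntegrable_iff_integrableOn_Ioc_of_le hx]
    exact (FAS.integrableOn_sumDensity hω' hμ₀ hμ₁ hx₀ hv hK).mono_set Set.Ioc_subset_Ioi_self
  -- Nonnegativity of `z` identifies the oriented integral over `0..z/K` with the one over `Set.Ioc
  -- 0 (z / K)`.
  · have hz0 : 0 ≤ z := by
      rw [hz, sub_nonneg]
      exact Real.one_le_rpow one_le_two hR
    have hev : {s | Real.logb 2 (1 + ∑ m ∈ sel s, γ s m) ≤ R} =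
        {s | ∑ m ∈ sel s, γ s m ≤ z} := by
      ext s
      have hsum : 0 ≤ ∑ m ∈ sel s, γ s m :=
        Finset.sum_nonneg fun m _ => (hγ s m).symm ▸ FAS.snr_nonneg hPS.le σ _
      rw [Set.mem_ofPred_eq, Set.mem_ofPred_eq,
        Real.logb_le_iff_le_rpow one_lt_two (by linarith), hz, le_sub_iff_add_le']
    rw [hev, FAS.real_outage_eq_integral hPS hσ hα hμ₀ hμ₁ hφ hω hh₀ he hindep hγ hK hKM hT z hsel,
      integral_prod _ hint]
    congr 1 with x₀
    rw [intervalIntegral.integral_of_le (by positivity)]
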